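/- Let $d\ge 1$ be an integer and let $\mathbf F(a,b;c;z)={}_2F_1(a,b;c;z)/\Gamma(c)$ be the regularized hypergeometric function, i.e. the holomorphic continuation of $\sum_{n\ge0}\frac{(a)_n(b)_n}{\Gamma(c+n)\,n!}z^n$ from the unit disc to the cut plane $\mathbb C\setminus[1,\infty)$. For $\lambda\in\mathbb C$ let $$G^{(d)}_\lambda(\sigma)=\frac{\Gamma(\frac d2+i\lambda)\,\Gamma(\frac d2-i\lambda)}{(4\pi)^{\frac{d+1}{2}}}\,\mathbf F\!\left(\tfrac d2+i\lambda,\tfrac d2-i\lambda;\tfrac{d+1}{2};\tfrac{1+\sigma}{2}\right)$$ be the free scalar propagator of de Sitter space $\mathrm{dS}_{d+1}$ (of radius $1$) in the Bunch–Davies vacuum. Suppose that $\lambda$ is in the principal series ($\lambda\in\mathbb R$) or in the complementary series ($i\lambda\in(-\frac d2,\frac d2)$). Then $G^{(d)}_\lambda$ is holomorphic on $\{\sigma\in\mathbb C:\frac{1+\sigma}{2}\notin[1,\infty)\}=\mathbb C\setminus[1,\infty)$, and there are real numbers $B_n(d,\lambda)\ge 0$, $n\ge0$, such that $$G^{(d)}_\lambda(\sigma)=\sum_{n=0}^\infty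 B_n(d,\lambda)\,\rho^n$$ with a convergent series for all complex $\sigma,\rho$ with $|\rho|<1$ and $\frac{1+\sigma}{2}=\frac{4\rho}{(1+\rho)^2}$. If $\lambda$ is in the complementary series, then moreover $B_n(d,\lambda)>0$ for all $n\ge0$. -/

import Mathlib

namespace DeSitter

/-- The cut plane `ℂ \ [1, +∞)`. -/
def cutPlane : Set ℂ := (Complex.ofReal '' Set.Ici (1 : ℝ))ᶜ

/-- `F` is a holomorphic function on the cut plane which on the unit disc is the sum of the
regularized Gauss series `∑ (a)_n (b)_n / (Γ(c + n) n!) z ^ n`. -/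
def IsHypergeometricContinuation (a b c : ℂ) (F : ℂ → ℂ) : Prop :=
  DifferentiableOn ℂ F cutPlane ∧
    ∀ z : ℂ, ‖z‖ < 1 → F z = Complex.regularizedGaussHGFun a b c z

open Classical in
/-- The regularized hypergeometric function `𝐅(a, b; c; z) = ₂F₁(a, b; c; z) / Γ(c)` on the cut
plane, i.e. the holomorphic continuation of the regularized Gauss series from the unit disc to
`ℂ \ [1, +∞)` (unique there by `IsHypergeometricContinuation.eqOn`). The `else` branch only makes
the definition total; in either branch the value for `‖z‖ < 1` is the sum of the Gauss series. -/
noncomputable def regularizedF (a b c : ℂ) : ℂ → ℂ :=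
  if h : ∃ F : ℂ → ℂ, IsHypergeometricContinuation a b c F then h.choose
  else Complex.regularizedGaussHGFun a b c

theorem mem_cutPlane_iff {z : ℂ} : z ∈ cutPlane ↔ 1 - z ∈ Complex.slitPlane := by
  rw [Complex.mem_slitPlane_iff_not_le_zero, cutPlane, Set.mem_compl_iff, not_iff_not]
  constructor
  · rintro ⟨x, hx, rfl⟩
    rw [Set.mem_Ici] at hx
    rw [Complex.le_def]
    simp [hx]
  · intro h
    rw [Complex.le_def] at h
    simp only [Complex.sub_re, Complex.one_re, Complex.zero_re, Complex.sub_im, Complex.one_im,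
      Complex.zero_im] at h
    refine ⟨z.re, ?_, ?_⟩
    · rw [Set.mem_Ici]; linarith [h.1]
    · apply Complex.ext
      · simp
      · simp only [Complex.ofReal_im]; linarith [h.2]

theorem IsHypergeometricContinuation.eqOn {a b c : ℂ} {F F' : ℂ → ℂ}
    (h : IsHypergeometricContinuation a b c F) (h' : IsHypergeometricContinuation a b c F') :
    Set.EqOn F F' cutPlane := by
  have hpre : cutPlane = (fun z : ℂ => 1 - z) ⁻¹' Complex.slitPlane := by
    ext z; exact mem_cutPlane_iff
  have hopen : IsOpen cutPlane := by
    rw [hpre]; exact Complex.isOpen_slitPlane.preimage (by fun_prop)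
  have hconn : IsPreconnected cutPlane := by
    have himg : cutPlane = (fun z : ℂ => 1 - z) '' Complex.slitPlane := by
      rw [hpre]
      ext z
      constructor
      · intro hz; exact ⟨1 - z, hz, by simp⟩
      · rintro ⟨w, hw, rfl⟩; simpa using hw
    rw [himg]
    have hs : IsPreconnected Complex.slitPlane :=
      (Complex.starConvex_one_slitPlane.isPathConnected
        Complex.one_mem_slitPlane).isConnected.isPreconnected
    exact hs.image _ (by fun_prop)
  refine (h.1.analyticOnNhd hopen).eqOn_of_preconnected_of_eventuallyEq (h'.1.analyticOnNhd hopen)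
    hconn (z₀ := 0) (mem_cutPlane_iff.2 (by simp)) ?_
  filter_upwards [Metric.ball_mem_nhds (0 : ℂ) one_pos] with z hz
  rw [mem_ball_zero_iff] at hz
  rw [h.2 z hz, h'.2 z hz]

theorem regularizedF_eq_of_norm_lt_one (a b c : ℂ) {z : ℂ} (hz : ‖z‖ < 1) :
    regularizedF a b c z = Complex.regularizedGaussHGFun a b c z := by
  unfold regularizedF
  split_ifs with h
  · exact h.choose_spec.2 z hz
  · rfl

/-- The Bunch–Davies free propagator of `dS_{d+1}` of unit radius and mass `m² = d²/4 + lam²`, as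
a function of the two-point invariant `σ`. -/
noncomputable def freePropagator (d : ℕ) (lam σ : ℂ) : ℂ :=
  Complex.Gamma (d / 2 + Complex.I * lam) * Complex.Gamma (d / 2 - Complex.I * lam)
      / (((4 * Real.pi) ^ (((d : ℝ) + 1) / 2) : ℝ) : ℂ)
    * regularizedF (d / 2 + Complex.I * lam) (d / 2 - Complex.I * lam) ((d + 1) / 2)
        ((1 + σ) / 2)

/-- Principal series: `λ ∈ ℝ`. -/
def IsPrincipal (lam : ℂ) : Prop := ∃ x : ℝ, lam = x

/-- Complementary series: `iλ ∈ (-d/2, d/2)`. -/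
def IsComplementary (d : ℕ) (lam : ℂ) : Prop :=
  ∃ x : ℝ, x ∈ Set.Ioo (-(d : ℝ) / 2) ((d : ℝ) / 2) ∧ Complex.I * lam = x

end DeSitter

/-! The map `ρ ↦ 4ρ/(1+ρ)²` is a bijection from the unit disc onto the cut plane, so a power series
in `ρ` that represents the Gauss series for `0 < ρ < 1` converges on the whole disc and provides the
holomorphic continuation (`regularizedF_of_hasSum`). What remains is positivity of its coefficients;
the Gamma prefactor is positive. Write `z = 4ρ/(1+ρ)²`.

Principal series: the parameters `a`, `b` are complex conjugates. A Möbius substitution in Euler's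
integral (`integral_betaWeight_scaling`) makes it symmetric in `ρ`: apart from explicit powers of `1
± ρ`, the integrand depends on `ρ` through `(1 - xρ)^(a-c) (1 + xρ)^(-a)` with `x = 1 - 2s`. Let
`P_n(a)` be the Taylor coefficients of `(1 - t)^(a-c) (1 + t)^(-a)`. The Beta moments of `x ^ n` are
themselves proportional to `P_n(b) n!/(c)_n`, so the series has coefficients `P_n(a) P_n(b)
n!/((c)_n Γ(c))` (`hasSum_regularizedGauss_koebe`). For conjugate parameters and real `c` this
contains `|P_n(a)|²`. The remaining factor `(1+ρ)^d (1-ρ)^(-(d-1)/2)` has nonnegative coefficients.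

Complementary series: the parameters are real, `a = b + 2κ + 1` and `c = b + κ + 1`. The derivative
in `ρ` is a positive mean over `φ` of kernels whose logarithmic derivatives have nonnegative
coefficients and a positive constant term (`kernelLogCoeff_nonneg`, `kernelLogCoeff_zero_pos`). The
recursion for the exponential of a series makes every kernel coefficient positive. Integrating from
`ρ = 0`, where the value is `1/Γ(c) > 0`, finishes the argument (`exists_pos_radial_of_real`).
Differentiating first is essential: it contributes a factor `1/(1-ρ²)`, which adds `2` to each
odd-order logarithmic coefficient and compensates for negative `κ`. -/

namespace DeSitter

open MeasureTheory

/-! ### Power series on the open unit disc. -/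

/-- The coefficients `k` converge absolutely as a power series on the open unit disc. -/
def DiscSummable (k : ℕ → ℂ) : Prop :=
  ∀ r : ℝ, 0 ≤ r → r < 1 → Summable fun n => ‖k n‖ * r ^ n

theorem DiscSummable.summable_norm {k : ℕ → ℂ} (hk : DiscSummable k) {z : ℂ} (hz : ‖z‖ < 1) :
    Summable fun n => ‖k n * z ^ n‖ := by
  simpa using hk ‖z‖ (norm_nonneg z) hz

theorem DiscSummable.hasSum {k : ℕ → ℂ} (hk : DiscSummable k) {z : ℂ} (hz : ‖z‖ < 1) :
    HasSum (fun n => k n * z ^ n) (∑' n, k n * z ^ n) :=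
  (hk.summable_norm hz).of_norm.hasSum

theorem DiscSummable.mono {k m : ℕ → ℂ} (hm : DiscSummable m) (h : ∀ n, ‖k n‖ ≤ ‖m n‖) :
    DiscSummable k := fun r h0 h1 =>
  (hm r h0 h1).of_nonneg_of_le (fun n => by positivity) fun n => by gcongr; exact h n

theorem discSummable_choose (K : ℕ) : DiscSummable fun n => ((n + K).choose K : ℂ) := by
  intro r h0 h1
  simpa using summable_choose_mul_geometric_of_norm_lt_one K (r := r)
    (by rwa [Real.norm_of_nonneg h0])

/-- Convergence at all points of `(0, 1)` suffices. -/
theorem discSummable_of_hasSum {k : ℕ → ℂ} {f : ℝ → ℂ}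
    (h : ∀ t : ℝ, 0 < t → t < 1 → HasSum (fun n => k n * (t : ℂ) ^ n) (f t)) :
    DiscSummable k := by
  intro r h0 h1
  rcases h0.eq_or_lt with rfl | hr
  · exact summable_of_ne_finset_zero (s := {0}) fun n hn => by
      simp at hn; simp [hn]
  · simpa [abs_of_pos hr] using (h r hr h1).summable.norm

theorem DiscSummable.deriv {k : ℕ → ℂ} (hk : DiscSummable k) :
    DiscSummable fun n => (n + 1) * k (n + 1) := by
  intro r h0 h1
  -- The intermediate radius `q` leaves a factor `(r/q)^n`, which absorbs the factor `n` from
  -- differentiation.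
  obtain ⟨q, hrq, hq1⟩ := exists_between h1
  have hq0 : 0 < q := h0.trans_lt hrq
  have hb := (tendsto_self_mul_const_pow_of_lt_one (r := r / q) (by positivity)
    ((div_lt_one hq0).2 hrq)).bddAbove_range
  obtain ⟨C, hC⟩ := hb
  have hC' : ∀ n : ℕ, (n : ℝ) * (r / q) ^ n ≤ C := fun n => hC ⟨n, rfl⟩
  have hs := ((summable_nat_add_iff 1).2 (hk q hq0.le hq1)).mul_left ((C + 1) / q)
  have hg : Summable fun n : ℕ => ‖k (n + 1)‖ * (q ^ n * ((n : ℝ) * (r / q) ^ n + (r / q) ^ n)) := by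
    refine Summable.of_nonneg_of_le (fun n => by positivity) (fun n => ?_) hs
    have h1 : (r / q) ^ n ≤ 1 := pow_le_one₀ (by positivity) ((div_le_one hq0).2 hrq.le)
    calc ‖k (n + 1)‖ * (q ^ n * ((n : ℝ) * (r / q) ^ n + (r / q) ^ n))
        ≤ ‖k (n + 1)‖ * (q ^ n * (C + 1)) := by gcongr; exact hC' n
      _ = (C + 1) / q * (‖k (n + 1)‖ * q ^ (n + 1)) := by rw [pow_succ]; field_simp
  refine hg.congr fun n => ?_
  have : ‖(n : ℂ) + 1‖ = n + 1 := by
    have := Complex.norm_natCast (n + 1); push_cast at this; exact this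
  rw [norm_mul, this, div_pow]
  field_simp

theorem DiscSummable.hasDerivAt {k : ℕ → ℂ} (hk : DiscSummable k) {z : ℂ} (hz : ‖z‖ < 1) :
    HasDerivAt (fun w => ∑' n, k n * w ^ n) (∑' n : ℕ, (n + 1) * k (n + 1) * z ^ n) z := by
  obtain ⟨r, hzr, hr1⟩ := exists_between hz
  have hr0 : 0 ≤ r := (norm_nonneg z).trans hzr.le
  have hu : Summable fun n : ℕ => ‖k n‖ * (n * r ^ (n - 1)) := by
    refine (summable_nat_add_iff 1).1 ((hk.deriv r hr0 hr1).congr fun n => ?_)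
    have : ‖(n : ℂ) + 1‖ = n + 1 := by
      have := Complex.norm_natCast (n + 1); push_cast at this; exact this
    rw [norm_mul, this]
    push_cast
    ring
  have h := hasDerivAt_tsum_of_isPreconnected (t := Metric.ball (0 : ℂ) r) (y₀ := 0) (y := z)
    (g := fun n w => k n * w ^ n) (g' := fun n w => k n * (n * w ^ (n - 1))) hu
    Metric.isOpen_ball (convex_ball _ _).isPreconnected
    (fun n y _ => (hasDerivAt_pow n y).const_mul (k n))
    (fun n y hy => by
      rw [mem_ball_zero_iff] at hy
      rw [norm_mul, norm_mul, norm_pow, Complex.norm_natCast]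
      gcongr)
    (by simpa using (norm_nonneg z).trans_lt hzr)
    (hk.summable_norm (by simp)).of_norm (by simpa using hzr)
  refine h.congr_deriv ?_
  have hs : Summable fun n : ℕ => k n * (n * z ^ (n - 1)) := by
    refine (summable_nat_add_iff 1).1 (((hk.deriv).hasSum hz).summable.congr fun n => ?_)
    push_cast
    ring
  rw [hs.tsum_eq_zero_add]
  simp only [Nat.cast_zero, zero_mul, mul_zero, zero_add, Nat.cast_add, Nat.cast_one,
    Nat.add_sub_cancel]
  exact tsum_congr fun n => by ring

theorem DiscSummable.differentiableOn {k : ℕ → ℂ} (hk : DiscSummable k) :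
    DifferentiableOn ℂ (fun w => ∑' n, k n * w ^ n) (Metric.ball 0 1) := fun _ hz =>
  (hk.hasDerivAt (mem_ball_zero_iff.1 hz)).differentiableAt.differentiableWithinAt

/-- The coefficients of the product of two power series. -/
def cauchyProduct {𝕜 : Type*} [Semiring 𝕜] (k m : ℕ → 𝕜) (n : ℕ) : 𝕜 :=
  ∑ p ∈ Finset.HasAntidiagonal.antidiagonal n, k p.1 * m p.2

theorem DiscSummable.hasSum_cauchyProduct {k m : ℕ → ℂ} (hk : DiscSummable k)
    (hm : DiscSummable m) {z : ℂ} (hz : ‖z‖ < 1) :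
    HasSum (fun n => cauchyProduct k m n * z ^ n) ((∑' n, k n * z ^ n) * ∑' n, m n * z ^ n) := by
  have h1 := hk.summable_norm hz
  have h2 := hm.summable_norm hz
  rw [tsum_mul_tsum_eq_tsum_sum_antidiagonal_of_summable_norm h1 h2]
  have h3 := (summable_norm_sum_mul_antidiagonal_of_summable_norm h1 h2).of_norm.hasSum
  have h4 : (fun n => cauchyProduct k m n * z ^ n) = fun n =>
      ∑ p ∈ Finset.HasAntidiagonal.antidiagonal n, k p.1 * z ^ p.1 * (m p.2 * z ^ p.2) := by
    ext n
    rw [cauchyProduct, Finset.sum_mul]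
    refine Finset.sum_congr rfl fun p hp => ?_
    rw [← Finset.HasAntidiagonal.mem_antidiagonal.1 hp, pow_add]
    ring
  rw [h4]
  exact h3

/-! ### Power series determined by their logarithmic derivative. -/

/-- The coefficients of the solution of `f' = G f`, `f(0) = 1`, where `G = ∑ g n * z ^ n`. -/
noncomputable def expCoeff {𝕜 : Type*} [Field 𝕜] (g : ℕ → 𝕜) : ℕ → 𝕜
  | 0 => 1
  | n + 1 => (∑ j : Fin (n + 1), g (n - j) * expCoeff g j) / (n + 1)

theorem expCoeff_zero {𝕜 : Type*} [Field 𝕜] (g : ℕ → 𝕜) : expCoeff g 0 = 1 := by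
  rw [expCoeff]

theorem expCoeff_succ {𝕜 : Type*} [Field 𝕜] (g : ℕ → 𝕜) (n : ℕ) :
    expCoeff g (n + 1) = (∑ j ∈ Finset.range (n + 1), g (n - j) * expCoeff g j) / (n + 1) := by
  rw [expCoeff, Finset.sum_range (fun j => g (n - j) * expCoeff g j)]

theorem ofReal_expCoeff (g : ℕ → ℝ) (n : ℕ) :
    ((expCoeff g n : ℝ) : ℂ) = expCoeff (fun j => (g j : ℂ)) n := by
  induction n using Nat.strong_induction_on with
  | _ n ih =>
    cases n with
    | zero => simp [expCoeff_zero]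
    | succ n =>
      rw [expCoeff_succ, expCoeff_succ]
      push_cast
      congr 1
      exact Finset.sum_congr rfl fun j hj => by rw [ih j (Finset.mem_range.1 hj)]

theorem conj_expCoeff (g : ℕ → ℂ) (n : ℕ) :
    (starRingEnd ℂ) (expCoeff g n) = expCoeff (fun j => (starRingEnd ℂ) (g j)) n := by
  induction n using Nat.strong_induction_on with
  | _ n ih =>
    cases n with
    | zero => simp [expCoeff_zero]
    | succ n =>
      rw [expCoeff_succ, expCoeff_succ]
      simp only [map_div₀, map_sum, map_mul, map_add, map_natCast, map_one]
      congr 1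
      exact Finset.sum_congr rfl fun j hj => by rw [ih j (Finset.mem_range.1 hj)]

theorem expCoeff_nonneg {g : ℕ → ℝ} (hg : ∀ n, 0 ≤ g n) (n : ℕ) : 0 ≤ expCoeff g n := by
  induction n using Nat.strong_induction_on with
  | _ n ih =>
    cases n with
    | zero => simp [expCoeff_zero]
    | succ n =>
      rw [expCoeff_succ]
      exact div_nonneg (Finset.sum_nonneg fun j hj =>
        mul_nonneg (hg _) (ih j (Finset.mem_range.1 hj))) (by positivity)

/-- In the recursion the term `j = n` carries the factor `g 0`, so positivity propagates from each
coefficient to the next. -/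
theorem expCoeff_pos {g : ℕ → ℝ} (hg : ∀ n, 0 ≤ g n) (h0 : 0 < g 0) (n : ℕ) :
    0 < expCoeff g n := by
  induction n with
  | zero => simp [expCoeff_zero]
  | succ n ih =>
    rw [expCoeff_succ]
    refine div_pos (Finset.sum_pos' (fun j _ => mul_nonneg (hg _) (expCoeff_nonneg hg j))
      ⟨n, by simp, ?_⟩) (by positivity)
    simpa using mul_pos h0 ih

/-- The majorant is `(1 - t)^(-(K+1))`, whose logarithmic derivative has constant coefficients `K +
1`. The bound is uniform in `g`, which later allows integration over a family of kernels. -/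
theorem norm_expCoeff_le {g : ℕ → ℂ} {K : ℕ} (hg : ∀ n, ‖g n‖ ≤ K) (n : ℕ) :
    ‖expCoeff g n‖ ≤ ((n + K).choose K : ℝ) := by
  induction n using Nat.strong_induction_on with
  | _ n ih =>
    cases n with
    | zero => simp [expCoeff_zero]
    | succ n =>
      have hn : ‖(n : ℂ) + 1‖ = n + 1 := by
        have := Complex.norm_natCast (n + 1); push_cast at this; exact this
      rw [expCoeff_succ, norm_div, hn, div_le_iff₀ (by positivity)]
      have h1 : ‖∑ j ∈ Finset.range (n + 1), g (n - j) * expCoeff g j‖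
          ≤ ∑ j ∈ Finset.range (n + 1), (K + 1 : ℝ) * ((j + K).choose K : ℝ) := by
        refine norm_sum_le_of_le _ fun j hj => ?_
        rw [norm_mul]
        have := hg (n - j)
        exact mul_le_mul (by linarith) (ih j (Finset.mem_range.1 hj)) (norm_nonneg _)
          (by positivity)
      refine h1.trans (le_of_eq ?_)
      rw [← Finset.mul_sum]
      -- The hockey-stick identity closes the induction; it is the reason for weakening `K` to `K +
      -- 1` above.
      have h2 := Nat.sum_range_add_choose n K
      have h3 := Nat.choose_succ_right_eq (n + K + 1) K
      have h4 : n + K + 1 - K = n + 1 := by omega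
      rw [h4] at h3
      have h2' : ∑ j ∈ Finset.range (n + 1), ((j + K).choose K : ℝ)
          = ((n + K + 1).choose (K + 1) : ℝ) := by exact_mod_cast h2
      have h3' : ((n + K + 1).choose (K + 1) : ℝ) * (K + 1) = ((n + K + 1).choose K : ℝ) * (n + 1) := by
        exact_mod_cast h3
      rw [h2', mul_comm, h3', show n + 1 + K = n + K + 1 by ring]

theorem discSummable_of_norm_le {g : ℕ → ℂ} {K : ℕ} (hg : ∀ n, ‖g n‖ ≤ K) : DiscSummable g := by
  intro r h0 h1
  exact ((summable_geometric_of_lt_one h0 h1).mul_left (K : ℝ)).of_nonneg_of_le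
    (fun n => by positivity) fun n => by gcongr; exact hg n

theorem discSummable_expCoeff {g : ℕ → ℂ} {K : ℕ} (hg : ∀ n, ‖g n‖ ≤ K) :
    DiscSummable (expCoeff g) :=
  (discSummable_choose K).mono fun n => by simpa using norm_expCoeff_le hg n

theorem hasDerivAt_tsum_expCoeff {g : ℕ → ℂ} {K : ℕ} (hg : ∀ n, ‖g n‖ ≤ K) {z : ℂ}
    (hz : ‖z‖ < 1) :
    HasDerivAt (fun w => ∑' n, expCoeff g n * w ^ n)
      ((∑' n, g n * z ^ n) * ∑' n, expCoeff g n * z ^ n) z := by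
  have h := (discSummable_expCoeff hg).hasDerivAt hz
  refine h.congr_deriv ?_
  rw [← ((discSummable_of_norm_le hg).hasSum_cauchyProduct (discSummable_expCoeff hg) hz).tsum_eq]
  refine tsum_congr fun n => ?_
  rw [expCoeff_succ, mul_div_cancel₀ _ (by exact_mod_cast n.succ_ne_zero), cauchyProduct,
    Finset.Nat.sum_antidiagonal_eq_sum_range_succ_mk, ← Finset.sum_range_reflect]
  congr 1
  refine Finset.sum_congr rfl fun j hj => ?_
  have : j ≤ n := Nat.lt_succ_iff.1 (Finset.mem_range.1 hj)
  simp only [Nat.add_sub_cancel]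
  rw [Nat.sub_sub_self this]

/-- A nowhere vanishing function with logarithmic derivative `∑ g n * t ^ n` on `(-1, 1)` is the
sum of the power series with coefficients `expCoeff g`. -/
theorem hasSum_expCoeff {g : ℕ → ℂ} {K : ℕ} (hg : ∀ n, ‖g n‖ ≤ K) {f G : ℝ → ℂ}
    (h0 : f 0 = 1) (hf : ∀ t ∈ Set.Ioo (-1 : ℝ) 1, f t ≠ 0)
    (hG : ∀ t ∈ Set.Ioo (-1 : ℝ) 1, HasSum (fun n => g n * (t : ℂ) ^ n) (G t))
    (hd : ∀ t ∈ Set.Ioo (-1 : ℝ) 1, HasDerivAt f (G t * f t) t)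
    {t : ℝ} (ht : t ∈ Set.Ioo (-1 : ℝ) 1) :
    HasSum (fun n => expCoeff g n * (t : ℂ) ^ n) (f t) := by
  set P : ℂ → ℂ := fun w => ∑' n, expCoeff g n * w ^ n with hP
  have hn : ∀ t ∈ Set.Ioo (-1 : ℝ) 1, ‖(t : ℂ)‖ < 1 := fun t ht => by
    rw [Complex.norm_real, Real.norm_eq_abs, abs_lt]; exact ht
  -- The series and `f` solve the same linear equation, so their quotient is constant.
  have hq : ∀ t ∈ Set.Ioo (-1 : ℝ) 1, HasDerivAt (fun t : ℝ => P t / f t) 0 t := by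
    intro t ht
    have h1 := (hasDerivAt_tsum_expCoeff hg (hn t ht)).comp_ofReal
    rw [(hG t ht).tsum_eq] at h1
    refine (h1.div (hd t ht) (hf t ht)).congr_deriv ?_
    rw [div_eq_zero_iff]
    left; ring
  have hconst : P t / f t = P (0 : ℝ) / f 0 := by
    refine IsOpen.is_const_of_deriv_eq_zero (s := Set.Ioo (-1 : ℝ) 1) isOpen_Ioo
      isPreconnected_Ioo (fun x hx => (hq x hx).differentiableAt.differentiableWithinAt)
      (fun x hx => (hq x hx).deriv) ht (by norm_num)
  have hP0 : P (0 : ℝ) = 1 := by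
    rw [hP]
    simp only [Complex.ofReal_zero]
    rw [tsum_eq_single 0 (fun n hn => by simp [hn])]
    simp [expCoeff_zero]
  rw [hP0, h0, div_one, div_eq_one_iff_eq (hf t ht)] at hconst
  rw [← hconst]
  exact (discSummable_expCoeff hg).hasSum (hn t ht)

/-! ### Uniqueness from values on the real interval. -/

theorem frequently_nhdsNE_zero_of_forall_Ioo {p : ℂ → Prop}
    (h : ∀ t : ℝ, 0 < t → t < 1 → p t) : ∃ᶠ z in nhdsWithin (0 : ℂ) {0}ᶜ, p z := by
  have h1 : Filter.Tendsto (fun t : ℝ => (t : ℂ)) (nhdsWithin 0 (Set.Ioi 0))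
      (nhdsWithin (0 : ℂ) {0}ᶜ) := by
    refine tendsto_nhdsWithin_iff.2 ⟨?_, ?_⟩
    · exact (Complex.continuous_ofReal.tendsto' 0 0 (by simp)).mono_left nhdsWithin_le_nhds
    · filter_upwards [self_mem_nhdsWithin] with t ht
      have : (0 : ℝ) < t := ht
      simpa using this.ne'
  refine h1.frequently (Filter.Eventually.frequently ?_)
  filter_upwards [Ioo_mem_nhdsGT (zero_lt_one' ℝ)] with t ht
  exact h t ht.1 ht.2

theorem DiscSummable.hasFPowerSeriesOnBall {k : ℕ → ℂ} (hk : DiscSummable k) :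
    HasFPowerSeriesOnBall (fun w => ∑' n, k n * w ^ n)
      (FormalMultilinearSeries.ofScalars ℂ k) 0 1 := by
  have hr : 1 ≤ (FormalMultilinearSeries.ofScalars ℂ k).radius := by
    refine ENNReal.le_of_forall_nnreal_lt fun r hr => ?_
    refine FormalMultilinearSeries.le_radius_of_summable _ ?_
    simpa [FormalMultilinearSeries.ofScalars_norm] using
      hk r r.2 (by exact_mod_cast hr)
  refine ⟨hr, one_pos, fun {y} hy => ?_⟩
  have hy' : ‖y‖ < 1 := by
    rw [← ENNReal.ofReal_one, Metric.eball_ofReal] at hy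
    simpa using hy
  simpa [FormalMultilinearSeries.ofScalars_apply_eq, mul_comm] using hk.hasSum hy'

/-- Two power series which agree on `(0, 1)` have the same coefficients. -/
theorem DiscSummable.eq_of_tsum_eq {k m : ℕ → ℂ} (hk : DiscSummable k) (hm : DiscSummable m)
    (h : ∀ t : ℝ, 0 < t → t < 1 → ∑' n, k n * (t : ℂ) ^ n = ∑' n, m n * (t : ℂ) ^ n) :
    k = m := by
  have h1 := hk.hasFPowerSeriesOnBall.hasFPowerSeriesAt
  have h2 := hm.hasFPowerSeriesOnBall.hasFPowerSeriesAt
  have h3 := (h1.analyticAt.frequently_eq_iff_eventually_eq h2.analyticAt).1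
    (frequently_nhdsNE_zero_of_forall_Ioo h)
  have h4 := h1.eq_formalMultilinearSeries_of_eventually h2 h3
  exact FormalMultilinearSeries.ofScalars_series_injective ℂ ℂ h4

/-! ### Complex powers of positive reals and Beta integrals. -/

theorem ofReal_cpow_eq_exp {x : ℝ} (hx : 0 < x) (p : ℂ) :
    (x : ℂ) ^ p = Complex.exp (p * (Real.log x : ℝ)) := by
  rw [Complex.cpow_def_of_ne_zero (by exact_mod_cast hx.ne'), Complex.ofReal_log hx.le, mul_comm]

theorem ofReal_cpow_ne_zero {x : ℝ} (hx : 0 < x) (p : ℂ) : (x : ℂ) ^ p ≠ 0 := by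
  rw [ofReal_cpow_eq_exp hx]; exact Complex.exp_ne_zero _

theorem hasDerivAt_ofReal_cpow {u : ℝ → ℝ} {u' t : ℝ} (hu : HasDerivAt u u' t) (h : 0 < u t)
    (p : ℂ) : HasDerivAt (fun x => ((u x : ℝ) : ℂ) ^ p)
      (p * ((u' / u t : ℝ) : ℂ) * ((u t : ℝ) : ℂ) ^ p) t := by
  have h1 : HasDerivAt (fun x => Complex.exp (p * (Real.log (u x) : ℝ)))
      (Complex.exp (p * (Real.log (u t) : ℝ)) * (p * ((u' / u t : ℝ) : ℂ))) t :=
    (((hu.log h.ne').ofReal_comp).const_mul p).cexp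
  rw [ofReal_cpow_eq_exp h, mul_comm]
  refine h1.congr_of_eventuallyEq ?_
  filter_upwards [hu.continuousAt.eventually (lt_mem_nhds h)] with x hx
  exact ofReal_cpow_eq_exp hx p

/-- The weight of Euler's Beta integral. -/
noncomputable def betaWeight (p q : ℂ) (s : ℝ) : ℂ := (s : ℂ) ^ (p - 1) * ((1 - s : ℝ) : ℂ) ^ (q - 1)

theorem integral_betaWeight (p q : ℂ) :
    ∫ s in Set.Ioo (0 : ℝ) 1, betaWeight p q s = Complex.betaIntegral p q := by
  rw [Complex.betaIntegral, intervalIntegral.integral_of_le zero_le_one,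
    integral_Ioc_eq_integral_Ioo]
  simp [betaWeight]

theorem integrableOn_betaWeight {p q : ℂ} (hp : 0 < p.re) (hq : 0 < q.re) :
    IntegrableOn (betaWeight p q) (Set.Ioo 0 1) := by
  have h := Complex.betaIntegral_convergent hp hq
  rw [intervalIntegrable_iff_integrableOn_Ioo_of_le zero_le_one] at h
  refine h.congr_fun (fun s _ => ?_) measurableSet_Ioo
  simp [betaWeight]

theorem integral_betaWeight_mul_pow {p q : ℂ} (hp : 0 < p.re) (hq : 0 < q.re) (n : ℕ) :
    ∫ s in Set.Ioo (0 : ℝ) 1, betaWeight p q s * (s : ℂ) ^ n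
      = Complex.Gamma p * Complex.Gamma q * (ascPochhammer ℂ n).eval p /
        Complex.Gamma (p + q + n) := by
  have h1 : ∫ s in Set.Ioo (0 : ℝ) 1, betaWeight p q s * (s : ℂ) ^ n
      = Complex.betaIntegral (p + n) q := by
    rw [← integral_betaWeight]
    refine setIntegral_congr_fun measurableSet_Ioo fun s hs => ?_
    have hs0 : (s : ℂ) ≠ 0 := by exact_mod_cast hs.1.ne'
    simp only [betaWeight]
    rw [show p + n - 1 = (p - 1) + n by ring, Complex.cpow_add _ _ hs0, Complex.cpow_natCast]
    ring
  have hre : 0 < (p + n : ℂ).re := by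
    simp only [Complex.add_re, Complex.natCast_re]; positivity
  have h2 := Complex.Gamma_mul_Gamma_eq_betaIntegral hre hq
  have h3 : Complex.Gamma (p + n + q) ≠ 0 := Complex.Gamma_ne_zero_of_re_pos (by
    rw [Complex.add_re]; positivity)
  have h4 := Complex.Gamma_add_nat_div_Gamma_eq (n := n) p (fun k hk => by
    rw [hk] at hp; simp at hp; linarith [k.cast_nonneg (α := ℝ)])
  have h5 : Complex.Gamma p ≠ 0 := Complex.Gamma_ne_zero_of_re_pos hp
  rw [div_eq_iff h5] at h4
  rw [h1, show p + q + n = p + n + q by ring, eq_div_iff h3, mul_comm, ← h2, h4]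
  ring

/-- Termwise integration against the Beta weight. -/
theorem hasSum_integral_betaWeight_mul {p q : ℂ} (hp : 0 < p.re) (hq : 0 < q.re)
    {k : ℕ → ℝ → ℂ} (hk : ∀ n, Measurable (k n)) {M : ℕ → ℝ}
    (hM : ∀ n, ∀ s ∈ Set.Ioo (0 : ℝ) 1, ‖k n s‖ ≤ M n) (hMs : Summable M) {f : ℝ → ℂ}
    (hf : ∀ s ∈ Set.Ioo (0 : ℝ) 1, HasSum (fun n => k n s) (f s)) :
    HasSum (fun n => ∫ s in Set.Ioo (0 : ℝ) 1, betaWeight p q s * k n s)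
      (∫ s in Set.Ioo (0 : ℝ) 1, betaWeight p q s * f s) := by
  have hw := integrableOn_betaWeight hp hq
  have hb : ∀ n, ∀ᵐ s ∂volume.restrict (Set.Ioo (0 : ℝ) 1), ‖k n s‖ ≤ M n := fun n => by
    filter_upwards [ae_restrict_mem measurableSet_Ioo] with s hs using hM n s hs
  have hint : ∀ n, Integrable (fun s => betaWeight p q s * k n s)
      (volume.restrict (Set.Ioo (0 : ℝ) 1)) := fun n =>
    hw.mul_bdd (hk n).aestronglyMeasurable (hb n)
  have hsum : Summable fun n => ∫ s in Set.Ioo (0 : ℝ) 1, ‖betaWeight p q s * k n s‖ := by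
    refine (hMs.mul_left (∫ s in Set.Ioo (0 : ℝ) 1, ‖betaWeight p q s‖)).of_nonneg_of_le
      (fun n => integral_nonneg fun _ => norm_nonneg _) fun n => ?_
    rw [← integral_mul_const]
    refine integral_mono_ae (hint n).norm (hw.norm.mul_const _) ?_
    filter_upwards [hb n] with s hs
    rw [norm_mul]
    gcongr
  have h := hasSum_integral_of_summable_integral_norm hint hsum
  convert! h using 1
  refine setIntegral_congr_fun measurableSet_Ioo fun s hs => ?_
  exact ((hf s hs).mul_left _).tsum_eq.symm

/-- Invariance of the Euler integral under the Möbius transformations `s ↦ l s / (1 - s + l s)`. -/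
theorem integral_betaWeight_scaling {A B l : ℝ} (hA : 0 < A) (hB : 0 < B) (hl : 0 < l)
    {p q α β : ℂ} (h : α + β = p + q) :
    ∫ s in Set.Ioo (0 : ℝ) 1, betaWeight p q s *
        (((1 - s + A * s : ℝ) : ℂ) ^ (-α) * ((1 - s + B * s : ℝ) : ℂ) ^ (-β))
      = (l : ℂ) ^ p * ∫ s in Set.Ioo (0 : ℝ) 1, betaWeight p q s *
        (((1 - s + l * A * s : ℝ) : ℂ) ^ (-α) * ((1 - s + l * B * s : ℝ) : ℂ) ^ (-β)) := by
  set φ : ℝ → ℝ := fun s => l * s / (1 - s + l * s) with hφ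
  have hN : ∀ s ∈ Set.Ioo (0 : ℝ) 1, 0 < 1 - s + l * s := fun s hs => by
    have := hs.1; have := hs.2; have := mul_pos hl hs.1; linarith
  have hφ' : ∀ s ∈ Set.Ioo (0 : ℝ) 1, HasDerivWithinAt φ (l / (1 - s + l * s) ^ 2)
      (Set.Ioo 0 1) s := fun s hs => by
    have h1 : HasDerivAt (fun s : ℝ => l * s) l s := by
      simpa using (hasDerivAt_id s).const_mul l
    have h2 : HasDerivAt (fun s : ℝ => 1 - s + l * s) (-1 + l) s := by
      exact ((hasDerivAt_id' s).const_sub 1).add h1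
    refine ((h1.div h2 (hN s hs).ne').congr_deriv ?_).hasDerivWithinAt
    congr 1; ring
  have hinj : Set.InjOn φ (Set.Ioo 0 1) := by
    intro s hs t ht hst
    simp only [hφ] at hst
    rw [div_eq_div_iff (hN s hs).ne' (hN t ht).ne'] at hst
    have : l * (s - t) = 0 := by linear_combination hst
    rcases mul_eq_zero.1 this with h | h
    · exact absurd h hl.ne'
    · linarith
  have himg : φ '' Set.Ioo 0 1 = Set.Ioo 0 1 := by
    ext y
    constructor
    · rintro ⟨s, hs, rfl⟩
      have := mul_pos hl hs.1
      refine ⟨div_pos this (hN s hs), (div_lt_one (hN s hs)).2 ?_⟩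
      have := hs.2
      linarith
    · rintro ⟨h0, h1⟩
      have hD : 0 < l * (1 - y) + y := by
        have := mul_pos hl (sub_pos.2 h1); linarith
      have hD' : 0 < l * (1 - y) := mul_pos hl (sub_pos.2 h1)
      refine ⟨y / (l * (1 - y) + y), ⟨div_pos h0 hD, (div_lt_one hD).2 (by linarith)⟩, ?_⟩
      simp only [hφ]
      have : 1 - y / (l * (1 - y) + y) + l * (y / (l * (1 - y) + y)) = l / (l * (1 - y) + y) := by
        field_simp; ring
      rw [this]
      field_simp
  have hcv := integral_image_eq_integral_abs_deriv_smul measurableSet_Ioo hφ' hinj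
    (fun s => betaWeight p q s *
        (((1 - s + A * s : ℝ) : ℂ) ^ (-α) * ((1 - s + B * s : ℝ) : ℂ) ^ (-β)))
  rw [himg] at hcv
  rw [hcv, ← integral_const_mul]
  refine setIntegral_congr_fun measurableSet_Ioo fun s hs => ?_
  have hs0 := hs.1
  have hs1 : 0 < 1 - s := sub_pos.2 hs.2
  have hNs := hN s hs
  have hlin : ∀ C : ℝ, 0 < C → 0 < 1 - s + l * C * s ∧
      1 - φ s + C * φ s = (1 - s + l * C * s) / (1 - s + l * s) := fun C hC => by
    refine ⟨by have := mul_pos (mul_pos hl hC) hs0; linarith, ?_⟩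
    simp only [hφ]; field_simp; ring
  have h1φ : 1 - φ s = (1 - s) / (1 - s + l * s) := by simp only [hφ]; field_simp; ring
  obtain ⟨hA0, hA1⟩ := hlin A hA
  obtain ⟨hB0, hB1⟩ := hlin B hB
  simp only [betaWeight]
  rw [hA1, hB1, h1φ, abs_of_pos (by positivity), Complex.real_smul]
  simp only [hφ]
  -- With the Jacobian also written as an exponential, the identity of integrands becomes linear in
  -- logarithms. The coefficient of `log (1 - s + l s)` is `α + β - p - q`, which vanishes by `h`.
  have hexp : ((l / (1 - s + l * s) ^ 2 : ℝ) : ℂ)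
      = Complex.exp ((Real.log l : ℝ) - 2 * (Real.log (1 - s + l * s) : ℝ)) := by
    rw [← Complex.cpow_one ((l / (1 - s + l * s) ^ 2 : ℝ) : ℂ),
      ofReal_cpow_eq_exp (by positivity), Real.log_div hl.ne' (by positivity), Real.log_pow]
    push_cast
    ring_nf
  rw [hexp, ofReal_cpow_eq_exp (by positivity), ofReal_cpow_eq_exp (by positivity),
    ofReal_cpow_eq_exp (by positivity), ofReal_cpow_eq_exp (by positivity),
    ofReal_cpow_eq_exp hs0, ofReal_cpow_eq_exp hs1, ofReal_cpow_eq_exp hA0,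
    ofReal_cpow_eq_exp hB0, ofReal_cpow_eq_exp hl,
    Real.log_div (by positivity) hNs.ne', Real.log_div hs1.ne' hNs.ne',
    Real.log_div hA0.ne' hNs.ne', Real.log_div hB0.ne' hNs.ne', Real.log_mul hl.ne' hs0.ne']
  simp only [← Complex.exp_add]
  congr 1
  push_cast
  linear_combination (Real.log (1 - s + l * s) : ℂ) * h

/-! ### The binomial series and Euler's integral. -/

theorem expCoeff_const (a : ℂ) (n : ℕ) :
    expCoeff (fun _ => a) n = (ascPochhammer ℂ n).eval a / n.factorial := by
  have hrec : ∀ n : ℕ, (n + 1 : ℂ) * expCoeff (fun _ => a) (n + 1)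
      = (a + n) * expCoeff (fun _ => a) n := by
    have h0 : ∀ n : ℕ, (n + 1 : ℂ) * expCoeff (fun _ => a) (n + 1)
        = ∑ j ∈ Finset.range (n + 1), a * expCoeff (fun _ => a) j := fun n => by
      rw [expCoeff_succ, mul_div_cancel₀ _ (by exact_mod_cast n.succ_ne_zero)]
    intro n
    cases n with
    | zero => simpa using h0 0
    | succ n =>
      rw [h0, Finset.sum_range_succ, ← h0 n]
      push_cast
      ring
  induction n with
  | zero => simp [expCoeff_zero]
  | succ n ih =>
    have hn : (n + 1 : ℂ) ≠ 0 := by exact_mod_cast n.succ_ne_zero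
    have hf : (n.factorial : ℂ) ≠ 0 := by exact_mod_cast n.factorial_ne_zero
    have := hrec n
    rw [ih] at this
    rw [ascPochhammer_succ_right, Nat.factorial_succ]
    simp only [Polynomial.eval_mul, Polynomial.eval_add, Polynomial.eval_X,
      Polynomial.eval_natCast]
    push_cast
    rw [eq_div_iff (mul_ne_zero hn hf)]
    field_simp at this
    linear_combination this

theorem hasSum_ofReal_geometric {t : ℝ} (ht : t ∈ Set.Ioo (-1 : ℝ) 1) (c : ℂ) :
    HasSum (fun n : ℕ => c * (t : ℂ) ^ n) (c * ((1 / (1 - t) : ℝ) : ℂ)) := by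
  have hn : ‖(t : ℂ)‖ < 1 := by
    rw [Complex.norm_real, Real.norm_eq_abs, abs_lt]; exact ht
  have := (hasSum_geometric_of_norm_lt_one hn).mul_left c
  simpa using this

/-- The binomial series. -/
theorem hasSum_one_sub_cpow (a : ℂ) {t : ℝ} (ht : t ∈ Set.Ioo (-1 : ℝ) 1) :
    HasSum (fun n => expCoeff (fun _ => a) n * (t : ℂ) ^ n) (((1 - t : ℝ) : ℂ) ^ (-a)) := by
  obtain ⟨K, hK⟩ := exists_nat_ge ‖a‖
  refine hasSum_expCoeff (K := K) (fun _ => hK) (f := fun t : ℝ => ((1 - t : ℝ) : ℂ) ^ (-a))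
    (G := fun t => a * ((1 / (1 - t) : ℝ) : ℂ)) (by simp)
    (fun t ht => ofReal_cpow_ne_zero (sub_pos.2 ht.2) _)
    (fun t ht => hasSum_ofReal_geometric ht a) (fun t ht => ?_) ht
  refine (hasDerivAt_ofReal_cpow ((hasDerivAt_id t).const_sub 1) (sub_pos.2 ht.2) (-a)).congr_deriv ?_
  simp [neg_div]

theorem hasSum_regularizedGauss (a b c : ℂ) {z : ℂ} (hz : ‖z‖ < 1) :
    HasSum (fun n : ℕ => (ascPochhammer ℂ n).eval a * (ascPochhammer ℂ n).eval b /
      (n.factorial * Complex.Gamma (c + n)) * z ^ n) (Complex.regularizedGaussHGFun a b c z) := by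
  have h := (Complex.regularizedGaussHGFunSeries a b c).hasSum (x := z) (by
    refine Metric.eball_subset_eball (Complex.radius_regularizedGaussHGFunSeries_ge_one a b c) ?_
    rw [← ENNReal.ofReal_one, Metric.eball_ofReal]
    simpa using hz)
  convert! h using 1
  ext n
  rw [FormalMultilinearSeries.apply_eq_pow_smul_coeff,
    Complex.coeff_regularizedGaussHGFunSeries, smul_eq_mul, mul_comm]

/-- Euler's integral for the regularized hypergeometric function. -/
theorem euler_integral {a b c : ℂ} (hb : 0 < b.re) (hc : 0 < (c - b).re) {z : ℝ}
    (hz : z ∈ Set.Ioo (0 : ℝ) 1) :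
    Complex.Gamma b * Complex.Gamma (c - b) * Complex.regularizedGaussHGFun a b c z
      = ∫ s in Set.Ioo (0 : ℝ) 1, betaWeight b (c - b) s * ((1 - z * s : ℝ) : ℂ) ^ (-a) := by
  have hzn : ‖(z : ℂ)‖ < 1 := by
    rw [Complex.norm_real, Real.norm_eq_abs, abs_lt]; exact ⟨by linarith [hz.1], hz.2⟩
  obtain ⟨K, hK⟩ := exists_nat_ge ‖a‖
  have h1 := hasSum_integral_betaWeight_mul hb hc
    (k := fun n s => expCoeff (fun _ => a) n * (z : ℂ) ^ n * (s : ℂ) ^ n)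
    (fun n => by fun_prop)
    (M := fun n => ‖expCoeff (fun _ => a) n * (z : ℂ) ^ n‖)
    (fun n s hs => by
      rw [norm_mul _ ((s : ℂ) ^ n), norm_pow (s : ℂ), Complex.norm_real,
        Real.norm_of_nonneg hs.1.le]
      exact mul_le_of_le_one_right (norm_nonneg _) (pow_le_one₀ hs.1.le hs.2.le))
    ((discSummable_expCoeff (fun _ => hK)).summable_norm hzn)
    (f := fun s => ((1 - z * s : ℝ) : ℂ) ^ (-a))
    (fun s hs => by
      have hzs : z * s ∈ Set.Ioo (-1 : ℝ) 1 := by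
        have h0 := mul_pos hz.1 hs.1
        have := mul_lt_one_of_nonneg_of_lt_one_left hz.1.le hz.2 hs.2.le
        exact ⟨by linarith, this⟩
      refine (hasSum_one_sub_cpow a hzs).congr_fun fun n => ?_
      push_cast; ring)
  refine (((hasSum_regularizedGauss a b c hzn).mul_left _).unique ?_)
  refine h1.congr_fun fun n => ?_
  have h2 : ∫ s in Set.Ioo (0 : ℝ) 1, betaWeight b (c - b) s *
      (expCoeff (fun _ => a) n * (z : ℂ) ^ n * (s : ℂ) ^ n)
      = expCoeff (fun _ => a) n * (z : ℂ) ^ n *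
        ∫ s in Set.Ioo (0 : ℝ) 1, betaWeight b (c - b) s * (s : ℂ) ^ n := by
    rw [← integral_const_mul]
    exact integral_congr_ae (Filter.Eventually.of_forall fun s => by ring)
  rw [h2, integral_betaWeight_mul_pow hb hc, expCoeff_const, add_sub_cancel]
  ring

/-! ### The radial variable and analytic continuation. -/

theorem mem_cutPlane_of_norm_lt_one {z : ℂ} (hz : ‖z‖ < 1) : z ∈ cutPlane := by
  rw [mem_cutPlane_iff, sub_eq_add_neg]
  exact Complex.mem_slitPlane_of_norm_lt_one (by simpa using hz)

theorem sq_mem_slitPlane {x : ℂ} (hx : 0 < x.re) : x ^ 2 ∈ Complex.slitPlane := by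
  rw [Complex.mem_slitPlane_iff]
  by_cases h : x.im = 0
  · left
    simp only [sq, Complex.mul_re, h]
    nlinarith
  · right
    simp only [sq, Complex.mul_im]
    intro h0
    have : x.re * x.im = 0 := by linarith
    rcases mul_eq_zero.1 this with h1 | h1
    · exact hx.ne' h1
    · exact h h1

theorem cpow_half_re_pos {w : ℂ} (hw : w ∈ Complex.slitPlane) : 0 < (w ^ (1 / 2 : ℂ)).re := by
  have h0 := Complex.slitPlane_ne_zero hw
  rw [Complex.cpow_def_of_ne_zero h0, Complex.exp_re]
  refine mul_pos (Real.exp_pos _) (Real.cos_pos_of_mem_Ioo ?_)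
  have him : (Complex.log w * (1 / 2)).im = w.arg / 2 := by
    rw [show (1 / 2 : ℂ) = ((1 / 2 : ℝ) : ℂ) by push_cast; ring, Complex.im_mul_ofReal,
      Complex.log_im]
    ring
  rw [him]
  have h1 := Complex.neg_pi_lt_arg w
  have h2 := lt_of_le_of_ne (Complex.arg_le_pi w) (Complex.mem_slitPlane_iff_arg.1 hw).1
  constructor <;> linarith

theorem one_add_ne_zero_of_re_pos {x : ℂ} (hx : 0 < x.re) : 1 + x ≠ 0 := fun h => by
  have := congrArg Complex.re h
  simp at this
  linarith

/-- The Cayley transform maps the right half plane to the unit disc. -/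
theorem norm_cayley_lt_one {x : ℂ} (hx : 0 < x.re) : ‖(1 - x) / (1 + x)‖ < 1 := by
  rw [norm_div, div_lt_one (norm_pos_iff.2 (one_add_ne_zero_of_re_pos hx)), Complex.norm_def,
    Complex.norm_def]
  refine Real.sqrt_lt_sqrt (Complex.normSq_nonneg _) ?_
  simp only [Complex.normSq_apply, Complex.sub_re, Complex.sub_im, Complex.add_re, Complex.add_im,
    Complex.one_re, Complex.one_im]
  nlinarith

theorem one_add_ne_zero_of_norm_lt_one {x : ℂ} (hx : ‖x‖ < 1) : 1 + x ≠ 0 := fun h => by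
  have : x = -1 := by linear_combination h
  simp [this] at hx

theorem cayley_re_pos {x : ℂ} (hx : ‖x‖ < 1) : 0 < ((1 - x) / (1 + x)).re := by
  have h1 : 0 < Complex.normSq (1 + x) := Complex.normSq_pos.2 (one_add_ne_zero_of_norm_lt_one hx)
  have h2 : Complex.normSq x < 1 := by
    rw [Complex.normSq_eq_norm_sq]
    exact pow_lt_one₀ (norm_nonneg x) hx two_ne_zero
  rw [Complex.div_re, ← add_div]
  refine div_pos ?_ h1
  simp only [Complex.normSq_apply] at h2
  simp only [Complex.sub_re, Complex.sub_im, Complex.add_re, Complex.add_im,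
    Complex.one_re, Complex.one_im]
  nlinarith

/-- The radial variable `ρ` as a function of `z = 4ρ / (1 + ρ) ^ 2`. -/
noncomputable def radial (z : ℂ) : ℂ := (1 - (1 - z) ^ (1 / 2 : ℂ)) / (1 + (1 - z) ^ (1 / 2 : ℂ))

theorem norm_radial_lt_one {z : ℂ} (hz : z ∈ cutPlane) : ‖radial z‖ < 1 :=
  norm_cayley_lt_one (cpow_half_re_pos (mem_cutPlane_iff.1 hz))

theorem differentiableOn_radial : DifferentiableOn ℂ radial cutPlane := by
  intro z hz
  have hz' := mem_cutPlane_iff.1 hz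
  have h1 : DifferentiableAt ℂ (fun z : ℂ => (1 - z) ^ (1 / 2 : ℂ)) z :=
    ((differentiableAt_const _).sub differentiableAt_id).cpow (differentiableAt_const _) hz'
  exact (((differentiableAt_const _).sub h1).div ((differentiableAt_const _).add h1)
    (one_add_ne_zero_of_re_pos (cpow_half_re_pos hz'))).differentiableWithinAt

/-- Since `1 - z` is the square of a Cayley transform with positive real part, the principal square
root recovers that transform, and hence `ρ`. -/
theorem one_sub_koebe {ρ : ℂ} (hρ : ‖ρ‖ < 1) :
    1 - 4 * ρ / (1 + ρ) ^ 2 = ((1 - ρ) / (1 + ρ)) ^ 2 := by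
  have := one_add_ne_zero_of_norm_lt_one hρ
  field_simp
  ring

theorem koebe_mem_cutPlane {ρ : ℂ} (hρ : ‖ρ‖ < 1) : 4 * ρ / (1 + ρ) ^ 2 ∈ cutPlane := by
  rw [mem_cutPlane_iff, one_sub_koebe hρ]
  exact sq_mem_slitPlane (cayley_re_pos hρ)

theorem radial_koebe {ρ : ℂ} (hρ : ‖ρ‖ < 1) : radial (4 * ρ / (1 + ρ) ^ 2) = ρ := by
  have := one_add_ne_zero_of_norm_lt_one hρ
  rw [radial, one_sub_koebe hρ, one_div, Complex.sq_cpow_two_inv (cayley_re_pos hρ)]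
  have h1 : 1 - (1 - ρ) / (1 + ρ) = 2 * ρ / (1 + ρ) := by field_simp; ring
  have h2 : 1 + (1 - ρ) / (1 + ρ) = 2 / (1 + ρ) := by field_simp; ring
  rw [h1, h2]
  field_simp

theorem koebe_mem_Ioo {ρ : ℝ} (h0 : 0 < ρ) (h1 : ρ < 1) :
    4 * ρ / (1 + ρ) ^ 2 ∈ Set.Ioo (0 : ℝ) 1 :=
  ⟨by positivity, (div_lt_one (by positivity)).2 (by nlinarith)⟩

/-- Every point of `(0, 1)` is of the form `4ρ / (1 + ρ) ^ 2` with `ρ` in `(0, 1)`. -/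
theorem exists_koebe_eq {t : ℝ} (h0 : 0 < t) (h1 : t < 1) :
    ∃ ρ : ℝ, 0 < ρ ∧ ρ < 1 ∧ 4 * ρ / (1 + ρ) ^ 2 = t := by
  have hs0 : 0 < Real.sqrt (1 - t) := Real.sqrt_pos.2 (by linarith)
  have hs1 : Real.sqrt (1 - t) < 1 := by
    rw [Real.sqrt_lt' one_pos]; linarith
  have hsq : Real.sqrt (1 - t) ^ 2 = 1 - t := Real.sq_sqrt (by linarith)
  set w := Real.sqrt (1 - t)
  refine ⟨(1 - w) / (1 + w), div_pos (by linarith) (by linarith),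
    (div_lt_one (by linarith)).2 (by linarith), ?_⟩
  have h2 : 1 + (1 - w) / (1 + w) = 2 / (1 + w) := by field_simp; ring
  rw [h2]
  field_simp
  linear_combination -4 * hsq

theorem differentiableOn_regularizedGauss (a b c : ℂ) :
    DifferentiableOn ℂ (Complex.regularizedGaussHGFun a b c) (Metric.ball 0 1) := by
  have hr := Complex.radius_regularizedGaussHGFunSeries_ge_one a b c
  have h := (Complex.regularizedGaussHGFunSeries a b c).hasFPowerSeriesOnBall
    (lt_of_lt_of_le one_pos hr)
  have h2 := h.differentiableOn
  refine h2.mono ?_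
  rw [← Metric.eball_ofReal, ENNReal.ofReal_one]
  exact Metric.eball_subset_eball hr

/-- A power series in `ρ` which represents the Gauss series for `0 < ρ < 1` yields the continuation
of the latter to the cut plane. -/
theorem regularizedF_of_hasSum {a b c : ℂ} {B : ℕ → ℂ}
    (h : ∀ ρ : ℝ, 0 < ρ → ρ < 1 → HasSum (fun n => B n * (ρ : ℂ) ^ n)
      (Complex.regularizedGaussHGFun a b c ((4 * ρ / (1 + ρ) ^ 2 : ℝ) : ℂ))) :
    DifferentiableOn ℂ (regularizedF a b c) cutPlane ∧
      ∀ ρ : ℂ, ‖ρ‖ < 1 → HasSum (fun n => B n * ρ ^ n)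
        (regularizedF a b c (4 * ρ / (1 + ρ) ^ 2)) := by
  have hB := discSummable_of_hasSum h
  -- The candidate continuation. It agrees with the Gauss series on `(0, 1)`, hence on the disc; its
  -- existence also selects the first branch in the definition of `regularizedF`.
  set F : ℂ → ℂ := fun z => ∑' n, B n * radial z ^ n with hF
  have hFd : DifferentiableOn ℂ F cutPlane :=
    hB.differentiableOn.comp differentiableOn_radial
      fun z hz => mem_ball_zero_iff.2 (norm_radial_lt_one hz)
  have hcont : IsHypergeometricContinuation a b c F := by
    refine ⟨hFd, fun z hz => ?_⟩
    have hsub : Metric.ball (0 : ℂ) 1 ⊆ cutPlane := fun w hw =>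
      mem_cutPlane_of_norm_lt_one (mem_ball_zero_iff.1 hw)
    refine ((hFd.mono hsub).analyticOnNhd Metric.isOpen_ball).eqOn_of_preconnected_of_frequently_eq
      ((differentiableOn_regularizedGauss a b c).analyticOnNhd Metric.isOpen_ball)
      (convex_ball _ _).isPreconnected (Metric.mem_ball_self one_pos)
      (frequently_nhdsNE_zero_of_forall_Ioo fun t h0 h1 => ?_) (mem_ball_zero_iff.2 hz)
    obtain ⟨ρ, hρ0, hρ1, rfl⟩ := exists_koebe_eq h0 h1
    rw [← (h ρ hρ0 hρ1).tsum_eq, hF]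
    have hn : ‖(ρ : ℂ)‖ < 1 := by
      rw [Complex.norm_real, Real.norm_of_nonneg hρ0.le]; exact hρ1
    have := radial_koebe hn
    push_cast
    simp only [this]
  have hreg : IsHypergeometricContinuation a b c (regularizedF a b c) := by
    have hex : ∃ F : ℂ → ℂ, IsHypergeometricContinuation a b c F := ⟨F, hcont⟩
    rw [regularizedF, dif_pos hex]
    exact hex.choose_spec
  refine ⟨hreg.1, fun ρ hρ => ?_⟩
  rw [hreg.eqOn hcont (koebe_mem_cutPlane hρ)]
  simp only [hF, radial_koebe hρ]
  exact hB.hasSum hρ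

/-! ### Conjugate parameters: a bilinear generating function. -/

theorem cauchyProduct_nonneg {B C : ℕ → ℝ} (hB : ∀ n, 0 ≤ B n) (hC : ∀ n, 0 ≤ C n) (n : ℕ) :
    0 ≤ cauchyProduct B C n :=
  Finset.sum_nonneg fun p _ => mul_nonneg (hB p.1) (hC p.2)

theorem hasSum_ofReal_cauchyProduct {B C : ℕ → ℝ} {f g : ℝ → ℂ}
    (hB : ∀ t : ℝ, 0 < t → t < 1 → HasSum (fun n => (B n : ℂ) * (t : ℂ) ^ n) (f t))
    (hC : ∀ t : ℝ, 0 < t → t < 1 → HasSum (fun n => (C n : ℂ) * (t : ℂ) ^ n) (g t))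
    {t : ℝ} (h0 : 0 < t) (h1 : t < 1) :
    HasSum (fun n => ((cauchyProduct B C n : ℝ) : ℂ) * (t : ℂ) ^ n) (f t * g t) := by
  have hn : ‖(t : ℂ)‖ < 1 := by
    rw [Complex.norm_real, Real.norm_of_nonneg h0.le]; exact h1
  have h := (discSummable_of_hasSum hB).hasSum_cauchyProduct (discSummable_of_hasSum hC) hn
  rw [(hB t h0 h1).tsum_eq, (hC t h0 h1).tsum_eq] at h
  refine h.congr_fun fun n => ?_
  simp only [cauchyProduct]
  push_cast
  rfl

theorem hasSum_one_add_pow (d : ℕ) (t : ℂ) :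
    HasSum (fun n => (((d.choose n : ℕ) : ℝ) : ℂ) * t ^ n) ((1 + t) ^ d) := by
  rw [add_comm, add_pow]
  have h := hasSum_sum_of_ne_finset_zero (L := .unconditional ℕ) (f := fun n => (((d.choose n : ℕ) : ℝ) : ℂ) * t ^ n)
    (s := Finset.range (d + 1)) fun n hn => by
      rw [Nat.choose_eq_zero_of_lt (by simpa using hn)]; simp
  convert! h using 1
  exact Finset.sum_congr rfl fun n _ => by simp [mul_comm]

/-- The Taylor coefficients of `(1 - t) ^ (a - c) * (1 + t) ^ (-a)`, which are up to normalization
the Meixner–Pollaczek polynomials at angle `π / 2`. -/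
noncomputable def meixnerCoeff (a c : ℂ) : ℕ → ℂ := expCoeff fun n => c - a - (-1) ^ n * a

theorem exists_norm_meixner_le (a c : ℂ) : ∃ K : ℕ, ∀ n : ℕ, ‖c - a - (-1) ^ n * a‖ ≤ K := by
  obtain ⟨K, hK⟩ := exists_nat_ge (‖c - a‖ + ‖a‖)
  exact ⟨K, fun n => (norm_sub_le _ _).trans (by simpa using hK)⟩

theorem discSummable_meixnerCoeff (a c : ℂ) : DiscSummable (meixnerCoeff a c) := by
  obtain ⟨K, hK⟩ := exists_norm_meixner_le a c
  exact discSummable_expCoeff hK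

theorem hasSum_meixnerCoeff (a c : ℂ) {t : ℝ} (ht : t ∈ Set.Ioo (-1 : ℝ) 1) :
    HasSum (fun n => meixnerCoeff a c n * (t : ℂ) ^ n)
      (((1 - t : ℝ) : ℂ) ^ (a - c) * ((1 + t : ℝ) : ℂ) ^ (-a)) := by
  obtain ⟨K, hK⟩ := exists_norm_meixner_le a c
  refine hasSum_expCoeff hK
    (f := fun t : ℝ => ((1 - t : ℝ) : ℂ) ^ (a - c) * ((1 + t : ℝ) : ℂ) ^ (-a))
    (G := fun t => (c - a) * ((1 / (1 - t) : ℝ) : ℂ) + (-a) * ((1 / (1 + t) : ℝ) : ℂ)) (by simp)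
    (fun t ht => mul_ne_zero (ofReal_cpow_ne_zero (sub_pos.2 ht.2) _)
      (ofReal_cpow_ne_zero (by linarith [ht.1]) _))
    (fun t ht => ?_) (fun t ht => ?_) ht
  · have h2 := hasSum_ofReal_geometric (t := -t) ⟨by linarith [ht.2], by linarith [ht.1]⟩ (-a)
    rw [sub_neg_eq_add] at h2
    refine ((hasSum_ofReal_geometric ht (c - a)).add h2).congr_fun fun n => ?_
    push_cast
    rw [neg_pow (t : ℂ)]
    ring
  · have h1 := hasDerivAt_ofReal_cpow ((hasDerivAt_id' t).const_sub 1) (sub_pos.2 ht.2) (a - c)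
    have h2 := hasDerivAt_ofReal_cpow ((hasDerivAt_id' t).const_add 1)
      (show 0 < 1 + t by linarith [ht.1]) (-a)
    refine (h1.mul h2).congr_deriv ?_
    push_cast
    ring

theorem conj_meixnerCoeff (a : ℂ) (c : ℝ) (n : ℕ) :
    (starRingEnd ℂ) (meixnerCoeff a c n) = meixnerCoeff ((starRingEnd ℂ) a) c n := by
  rw [meixnerCoeff, meixnerCoeff, conj_expCoeff]
  simp

/-- The moments of `1 - 2 s` with respect to the Beta weight. -/
noncomputable def betaMoment (p q : ℂ) (n : ℕ) : ℂ :=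
  ∫ s in Set.Ioo (0 : ℝ) 1, betaWeight p q s * ((1 - 2 * s : ℝ) : ℂ) ^ n

theorem hasSum_betaMoment {p q : ℂ} (hp : 0 < p.re) (hq : 0 < q.re) {k : ℕ → ℂ}
    (hk : DiscSummable k) {f : ℝ → ℂ}
    (hf : ∀ t ∈ Set.Ioo (-1 : ℝ) 1, HasSum (fun n => k n * (t : ℂ) ^ n) (f t))
    {t : ℝ} (ht : t ∈ Set.Ioo (0 : ℝ) 1) :
    HasSum (fun n => k n * betaMoment p q n * (t : ℂ) ^ n)
      (∫ s in Set.Ioo (0 : ℝ) 1, betaWeight p q s * f ((1 - 2 * s) * t)) := by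
  have hx : ∀ s ∈ Set.Ioo (0 : ℝ) 1, |1 - 2 * s| ≤ 1 := fun s hs => by
    rw [abs_le]; constructor <;> linarith [hs.1, hs.2]
  have htn : ‖(t : ℂ)‖ < 1 := by
    rw [Complex.norm_real, Real.norm_of_nonneg ht.1.le]; exact ht.2
  have h := hasSum_integral_betaWeight_mul hp hq
    (k := fun n s => k n * (t : ℂ) ^ n * ((1 - 2 * s : ℝ) : ℂ) ^ n)
    (fun n => by fun_prop)
    (M := fun n => ‖k n * (t : ℂ) ^ n‖)
    (fun n s hs => by
      rw [norm_mul _ (((1 - 2 * s : ℝ) : ℂ) ^ n), norm_pow ((1 - 2 * s : ℝ) : ℂ),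
        Complex.norm_real, Real.norm_eq_abs]
      exact mul_le_of_le_one_right (norm_nonneg _) (pow_le_one₀ (abs_nonneg _) (hx s hs)))
    (hk.summable_norm htn)
    (f := fun s => f ((1 - 2 * s) * t))
    (fun s hs => by
      have hst : (1 - 2 * s) * t ∈ Set.Ioo (-1 : ℝ) 1 := by
        rw [Set.mem_Ioo, ← abs_lt, abs_mul, abs_of_pos ht.1]
        exact (mul_le_of_le_one_left ht.1.le (hx s hs)).trans_lt ht.2
      refine (hf _ hst).congr_fun fun n => ?_
      rw [Complex.ofReal_mul, mul_pow]; ring)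
  refine h.congr_fun fun n => ?_
  rw [betaMoment, mul_right_comm, ← integral_const_mul]
  exact integral_congr_ae (Filter.Eventually.of_forall fun s => by ring)

/-- Multiplying by `t ^ n` and summing, the left side becomes the Beta mean of `(1 - xt)^(-c)`, `x =
1 - 2s`. The exponent is exactly `p + q`, so a Möbius substitution evaluates this mean in closed
form as a multiple of `(1 - t)^(b-c) (1 + t)^(-b)`. -/
theorem expCoeff_mul_betaMoment {b c : ℂ} (hb : 0 < b.re) (hc : 0 < (c - b).re) (n : ℕ) :
    expCoeff (fun _ => c) n * betaMoment b (c - b) n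
      = Complex.betaIntegral b (c - b) * meixnerCoeff b c n := by
  obtain ⟨K, hK⟩ := exists_nat_ge ‖c‖
  have hsum : ∀ t : ℝ, 0 < t → t < 1 →
      HasSum (fun n => expCoeff (fun _ => c) n * betaMoment b (c - b) n * (t : ℂ) ^ n)
      (Complex.betaIntegral b (c - b) *
        (((1 - t : ℝ) : ℂ) ^ (b - c) * ((1 + t : ℝ) : ℂ) ^ (-b))) := by
    intro t h0 h1
    have ht1 : 0 < 1 - t := sub_pos.2 h1
    have ht2 : 0 < 1 + t := by linarith
    have h := hasSum_betaMoment hb hc (discSummable_expCoeff (fun _ => hK))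
      (fun t ht => hasSum_one_sub_cpow c ht) ⟨h0, h1⟩
    -- On the left of the scaling identity only the bare weight remains; on the right `1 - s + l s`
    -- equals `(1 - (1 - 2s) t)/(1 - t)`.
    have hsc := integral_betaWeight_scaling (A := 1) (B := 1) (l := (1 + t) / (1 - t)) one_pos
      one_pos (by positivity) (p := b) (q := c - b) (α := c) (β := 0) (by ring)
    simp only [one_mul, sub_add_cancel, Complex.ofReal_one, Complex.one_cpow, mul_one, neg_zero,
      Complex.cpow_zero, integral_betaWeight] at hsc
    convert! h using 1
    rw [hsc, mul_right_comm, ← integral_const_mul]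
    refine setIntegral_congr_fun measurableSet_Ioo fun s hs => ?_
    have hpos : 0 < 1 - (1 - 2 * s) * t := by nlinarith [hs.1, hs.2, mul_pos hs.1 h0]
    have hdiv : 1 - s + (1 + t) / (1 - t) * s = (1 - (1 - 2 * s) * t) / (1 - t) := by
      field_simp; ring
    simp only [hdiv]
    rw [ofReal_cpow_eq_exp (by positivity), ofReal_cpow_eq_exp ht1, ofReal_cpow_eq_exp ht2,
      ofReal_cpow_eq_exp (by positivity), ofReal_cpow_eq_exp hpos, Real.log_div ht2.ne' ht1.ne',
      Real.log_div hpos.ne' ht1.ne', mul_left_comm]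
    simp only [← Complex.exp_add]
    congr 2
    push_cast
    ring
  have hk : DiscSummable fun n => expCoeff (fun _ => c) n * betaMoment b (c - b) n :=
    discSummable_of_hasSum hsum
  have hm : DiscSummable fun n => Complex.betaIntegral b (c - b) * meixnerCoeff b c n := by
    refine discSummable_of_hasSum (f := fun t => Complex.betaIntegral b (c - b) *
        (((1 - t : ℝ) : ℂ) ^ (b - c) * ((1 + t : ℝ) : ℂ) ^ (-b))) fun t h0 h1 => ?_
    simpa only [mul_assoc] using
      (hasSum_meixnerCoeff b c ⟨by linarith, h1⟩).mul_left (Complex.betaIntegral b (c - b))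
  refine congrFun (hk.eq_of_tsum_eq hm fun t h0 h1 => ?_) n
  rw [(hsum t h0 h1).tsum_eq]
  refine (HasSum.tsum_eq ?_).symm
  simpa only [mul_assoc] using
      (hasSum_meixnerCoeff b c ⟨by linarith, h1⟩).mul_left (Complex.betaIntegral b (c - b))

/-- The Gauss series as an Euler integral which is symmetric in the radial variable. -/
theorem regularizedGauss_koebe_eq_integral {a b c : ℂ} (hb : 0 < b.re) (hc : 0 < (c - b).re)
    {ρ : ℝ} (h0 : 0 < ρ) (h1 : ρ < 1) :
    Complex.Gamma b * Complex.Gamma (c - b) *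
        Complex.regularizedGaussHGFun a b c ((4 * ρ / (1 + ρ) ^ 2 : ℝ) : ℂ)
      = ((1 + ρ : ℝ) : ℂ) ^ (a + b) * ((1 - ρ : ℝ) : ℂ) ^ (c - a - b) *
        ∫ s in Set.Ioo (0 : ℝ) 1, betaWeight b (c - b) s *
          (((1 - (1 - 2 * s) * ρ : ℝ) : ℂ) ^ (a - c) *
            ((1 + (1 - 2 * s) * ρ : ℝ) : ℂ) ^ (-a)) := by
  have hρ1 : 0 < 1 - ρ := sub_pos.2 h1
  have hρ2 : 0 < 1 + ρ := by linarith
  have hz1 : 1 - 4 * ρ / (1 + ρ) ^ 2 = ((1 - ρ) / (1 + ρ)) ^ 2 := by field_simp; ring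
  -- Here `B = l⁻²`, so the scaled constants `l` and `l B` are reciprocal, interchanged by `ρ ↦ -ρ`.
  -- As `A = 1`, the exponent `α` is free and is set to `c - a` to meet the constraint on exponents.
  have hsc := integral_betaWeight_scaling (A := 1) (B := ((1 - ρ) / (1 + ρ)) ^ 2)
    (l := (1 + ρ) / (1 - ρ)) one_pos (by positivity) (by positivity) (p := b) (q := c - b)
    (α := c - a) (β := a) (by ring)
  have hB : ∀ s : ℝ, 1 - s + ((1 - ρ) / (1 + ρ)) ^ 2 * s = 1 - 4 * ρ / (1 + ρ) ^ 2 * s := by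
    intro s; rw [← hz1]; ring
  simp only [one_mul, sub_add_cancel, Complex.ofReal_one, Complex.one_cpow, hB] at hsc
  rw [euler_integral hb hc (koebe_mem_Ioo h0 h1), hsc, ← integral_const_mul, ← integral_const_mul]
  refine setIntegral_congr_fun measurableSet_Ioo fun s hs => ?_
  have hpos1 : 0 < 1 - (1 - 2 * s) * ρ := by nlinarith [hs.1, hs.2, mul_pos hs.1 h0]
  have hpos2 : 0 < 1 + (1 - 2 * s) * ρ := by
    nlinarith [hs.1, hs.2, mul_pos (sub_pos.2 hs.2) h0]
  have hd1 : 1 - s + (1 + ρ) / (1 - ρ) * 1 * s = (1 - (1 - 2 * s) * ρ) / (1 - ρ) := by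
    field_simp; ring
  have hd2 : 1 - s + (1 + ρ) / (1 - ρ) * ((1 - ρ) / (1 + ρ)) ^ 2 * s
      = (1 + (1 - 2 * s) * ρ) / (1 + ρ) := by
    field_simp; ring
  simp only [hd1, hd2]
  rw [ofReal_cpow_eq_exp (by positivity), ofReal_cpow_eq_exp (by positivity),
    ofReal_cpow_eq_exp (by positivity), ofReal_cpow_eq_exp hρ1, ofReal_cpow_eq_exp hρ2,
    ofReal_cpow_eq_exp hpos1, ofReal_cpow_eq_exp hpos2, Real.log_div hρ2.ne' hρ1.ne',
    Real.log_div hpos1.ne' hρ1.ne', Real.log_div hpos2.ne' hρ2.ne', mul_left_comm,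
    mul_left_comm _ (betaWeight _ _ _)]
  simp only [← Complex.exp_add]
  congr 2
  push_cast
  ring

/-- The bilinear generating function of the Meixner–Pollaczek polynomials. -/
theorem hasSum_regularizedGauss_koebe {a b c : ℂ} (hb : 0 < b.re) (hc : 0 < (c - b).re)
    {ρ : ℝ} (h0 : 0 < ρ) (h1 : ρ < 1) :
    HasSum (fun n => meixnerCoeff a c n * meixnerCoeff b c n / expCoeff (fun _ => c) n /
        Complex.Gamma c * (ρ : ℂ) ^ n)
      (((1 + ρ : ℝ) : ℂ) ^ (-(a + b)) * ((1 - ρ : ℝ) : ℂ) ^ (-(c - a - b)) *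
        Complex.regularizedGaussHGFun a b c ((4 * ρ / (1 + ρ) ^ 2 : ℝ) : ℂ)) := by
  have hρ1 : 0 < 1 - ρ := sub_pos.2 h1
  have hρ2 : 0 < 1 + ρ := by linarith
  have hcre : 0 < c.re := by
    have := hc; rw [Complex.sub_re] at this; linarith
  have hΓb : Complex.Gamma b ≠ 0 := Complex.Gamma_ne_zero_of_re_pos hb
  have hΓcb : Complex.Gamma (c - b) ≠ 0 := Complex.Gamma_ne_zero_of_re_pos hc
  have hΓc : Complex.Gamma c ≠ 0 := Complex.Gamma_ne_zero_of_re_pos hcre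
  have hβ := Complex.Gamma_mul_Gamma_eq_betaIntegral hb hc
  rw [add_sub_cancel] at hβ
  have hE : ∀ n, expCoeff (fun _ => c) n ≠ 0 := fun n => by
    rw [expCoeff_const]
    refine div_ne_zero ?_ (by exact_mod_cast n.factorial_ne_zero)
    rw [Ne, ascPochhammer_eval_eq_zero_iff]
    rintro ⟨k, -, hk⟩
    have := congrArg Complex.re hk
    simp at this
    linarith [k.cast_nonneg (α := ℝ)]
  have h := hasSum_betaMoment hb hc (discSummable_meixnerCoeff a c)
    (fun t ht => hasSum_meixnerCoeff a c ht) ⟨h0, h1⟩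
  have hint := regularizedGauss_koebe_eq_integral (a := a) hb hc h0 h1
  have h2 := h.mul_left (Complex.Gamma b * Complex.Gamma (c - b))⁻¹
  convert! h2 using 1
  · ext n
    have hm := expCoeff_mul_betaMoment hb hc n
    have hβ0 : Complex.betaIntegral b (c - b) ≠ 0 := fun h => by
      rw [h, mul_zero] at hβ
      exact mul_ne_zero hΓb hΓcb hβ
    rw [hβ, eq_div_of_mul_eq (hE n) ((mul_comm _ _).trans hm)]
    have := hE n
    field_simp
  · rw [Complex.cpow_neg, Complex.cpow_neg]
    have e1 := ofReal_cpow_ne_zero hρ2 (a + b)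
    have e2 := ofReal_cpow_ne_zero hρ1 (c - a - b)
    generalize (∫ s in Set.Ioo (0 : ℝ) 1, _ : ℂ) = I at hint ⊢
    generalize Complex.regularizedGaussHGFun a b c _ = F at hint ⊢
    field_simp
    linear_combination hint

/-- Nonnegativity of the radial coefficients for conjugate parameters. -/
theorem exists_nonneg_radial_of_conj {d : ℕ} (hd : 1 ≤ d) {a b : ℂ} (hab : a + b = d)
    (hconj : b = (starRingEnd ℂ) a) :
    ∃ B : ℕ → ℝ, (∀ n, 0 ≤ B n) ∧ ∀ ρ : ℝ, 0 < ρ → ρ < 1 →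
      HasSum (fun n => (B n : ℂ) * (ρ : ℂ) ^ n)
        (Complex.regularizedGaussHGFun a b ((d + 1) / 2) ((4 * ρ / (1 + ρ) ^ 2 : ℝ) : ℂ)) := by
  have hd' : (1 : ℝ) ≤ d := by exact_mod_cast hd
  set c : ℝ := ((d : ℝ) + 1) / 2 with hcdef
  have hcc : ((d : ℂ) + 1) / 2 = (c : ℂ) := by rw [hcdef]; push_cast; ring
  have hre : a.re + b.re = d := by
    have := congrArg Complex.re hab; simpa using this
  have hre' : b.re = a.re := by rw [hconj, Complex.conj_re]
  have hb : 0 < b.re := by linarith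
  have hc : 0 < ((c : ℂ) - b).re := by
    rw [Complex.sub_re, Complex.ofReal_re, hcdef]; linarith
  have hcpos : 0 < c := by rw [hcdef]; positivity
  set E : ℕ → ℝ := expCoeff fun _ => c with hE
  -- The two Meixner–Pollaczek factors are conjugate because `c` is real; their product is this
  -- squared modulus.
  set S : ℕ → ℝ := fun n => Complex.normSq (meixnerCoeff a c n) / E n / Real.Gamma c with hS
  set R : ℕ → ℝ := expCoeff fun _ => ((d : ℝ) - 1) / 2 with hR
  have hSnn : ∀ n, 0 ≤ S n := fun n =>
    div_nonneg (div_nonneg (Complex.normSq_nonneg _) (expCoeff_nonneg (fun _ => hcpos.le) n))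
      (Real.Gamma_pos_of_pos hcpos).le
  have hRnn : ∀ n, 0 ≤ R n := fun n => expCoeff_nonneg (fun _ => by linarith) n
  have hSsum : ∀ ρ : ℝ, 0 < ρ → ρ < 1 → HasSum (fun n => (S n : ℂ) * (ρ : ℂ) ^ n) _ :=
    fun ρ h0 h1 => (hasSum_regularizedGauss_koebe (a := a) hb hc h0 h1).congr_fun fun n => by
      have h3 : ((E n : ℝ) : ℂ) = expCoeff (fun _ => (c : ℂ)) n := ofReal_expCoeff _ n
      rw [← h3, hconj, ← conj_meixnerCoeff, Complex.mul_conj, Complex.Gamma_ofReal, hS]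
      push_cast
      rfl
  have hRsum : ∀ ρ : ℝ, 0 < ρ → ρ < 1 → HasSum (fun n => (R n : ℂ) * (ρ : ℂ) ^ n) _ :=
    fun ρ h0 h1 => (hasSum_one_sub_cpow ((((d : ℝ) - 1) / 2 : ℝ) : ℂ)
      (t := ρ) ⟨by linarith, h1⟩).congr_fun fun n => by rw [hR, ofReal_expCoeff]
  -- The first two factors are the coefficients of `(1 + ρ)^d` and `(1 - ρ)^(-(d-1)/2)`; the latter
  -- are nonnegative because `d ≥ 1`.
  refine ⟨cauchyProduct (cauchyProduct (fun n => ((d.choose n : ℕ) : ℝ)) R) S,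
    cauchyProduct_nonneg (cauchyProduct_nonneg (fun n => Nat.cast_nonneg _) hRnn) hSnn,
    fun ρ h0 h1 => ?_⟩
  have h := hasSum_ofReal_cauchyProduct (fun t h0 h1 => hasSum_ofReal_cauchyProduct
    (fun t _ _ => hasSum_one_add_pow d t) hRsum h0 h1) hSsum h0 h1
  convert! h using 1
  have hρ1 : 0 < 1 - ρ := sub_pos.2 h1
  have hρ2 : 0 < 1 + ρ := by linarith
  rw [hcc, hab, show (c : ℂ) - a - b = -((((d : ℝ) - 1) / 2 : ℝ) : ℂ) by
    rw [sub_sub, hab, hcdef]; push_cast; ring, neg_neg, Complex.cpow_neg, Complex.cpow_neg,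
    Complex.cpow_natCast]
  have e2 := ofReal_cpow_ne_zero hρ1 ((((d : ℝ) - 1) / 2 : ℝ) : ℂ)
  have e1 : (1 + (ρ : ℂ)) ^ d ≠ 0 := pow_ne_zero _ (by exact_mod_cast hρ2.ne')
  push_cast at e2 ⊢
  field_simp

/-! ### Real parameters: the radial derivative as a mean of positive kernels. -/

/-- In the regularized normalization `Γ(c + n + 1)` is read as `Γ((c + 1) + n)`, so the usual
division by `c` disappears and no condition on `c` is needed. -/
theorem hasDerivAt_regularizedGauss (a b c : ℂ) {z : ℂ} (hz : ‖z‖ < 1) :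
    HasDerivAt (Complex.regularizedGaussHGFun a b c)
      (a * b * Complex.regularizedGaussHGFun (a + 1) (b + 1) (c + 1) z) z := by
  set k : ℕ → ℂ := fun n => (ascPochhammer ℂ n).eval a * (ascPochhammer ℂ n).eval b /
      (n.factorial * Complex.Gamma (c + n)) with hkdef
  have hk : DiscSummable k := discSummable_of_hasSum (f := fun t =>
    Complex.regularizedGaussHGFun a b c t) fun t h0 h1 =>
      hasSum_regularizedGauss a b c (by
        rw [Complex.norm_real, Real.norm_of_nonneg h0.le]; exact h1)
  have h1 : (fun w => ∑' n, k n * w ^ n) =ᶠ[nhds z] Complex.regularizedGaussHGFun a b c := by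
    filter_upwards [Metric.isOpen_ball.mem_nhds (mem_ball_zero_iff.2 hz)] with w hw
    exact (hasSum_regularizedGauss a b c (mem_ball_zero_iff.1 hw)).tsum_eq
  refine ((hk.hasDerivAt hz).congr_of_eventuallyEq h1.symm).congr_deriv ?_
  rw [← ((hasSum_regularizedGauss (a + 1) (b + 1) (c + 1) hz).mul_left (a * b)).tsum_eq]
  refine tsum_congr fun n => ?_
  have hsucc : ∀ x : ℂ, (ascPochhammer ℂ (n + 1)).eval x
      = x * (ascPochhammer ℂ n).eval (x + 1) := fun x => by
    rw [ascPochhammer_succ_left]; simp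
  have hn : (n + 1 : ℂ) ≠ 0 := by exact_mod_cast n.succ_ne_zero
  simp only [hkdef, hsucc, Nat.factorial_succ]
  push_cast
  rw [show c + ((n : ℂ) + 1) = c + 1 + n by ring]
  field_simp

/-- Term by term integration of a power series from `0`. -/
theorem hasSum_of_hasDerivAt {f f' : ℝ → ℂ} (hf0 : ContinuousAt f 0)
    (hf : ∀ t ∈ Set.Ioo (0 : ℝ) 1, HasDerivAt f (f' t) t) {D B : ℕ → ℂ}
    (hD : ∀ t : ℝ, 0 < t → t < 1 → HasSum (fun n => D n * (t : ℂ) ^ n) (f' t))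
    (hB0 : B 0 = f 0) (hB : ∀ n : ℕ, (n + 1) * B (n + 1) = D n) {t : ℝ} (h0 : 0 < t) (h1 : t < 1) :
    HasSum (fun n => B n * (t : ℂ) ^ n) (f t) := by
  have hBs : DiscSummable B := by
    intro r hr0 hr1
    refine (summable_nat_add_iff 1).1 (((discSummable_of_hasSum hD) r hr0 hr1).of_nonneg_of_le
      (fun n => by positivity) fun n => ?_)
    have hn : ‖(n : ℂ) + 1‖ = n + 1 := by
      have := Complex.norm_natCast (n + 1); push_cast at this; exact this
    rw [← hB n, norm_mul, hn, pow_succ]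
    have : ‖B (n + 1)‖ * (r ^ n * r) ≤ ‖B (n + 1)‖ * (r ^ n * 1) := by gcongr
    have h2 : 0 ≤ (n : ℝ) * (‖B (n + 1)‖ * r ^ n) := by positivity
    linarith
  have hnorm : ∀ t ∈ Set.Ioo (-1 : ℝ) 1, ‖(t : ℂ)‖ < 1 := fun t ht => by
    rw [Complex.norm_real, Real.norm_eq_abs, abs_lt]; exact ht
  have hder : ∀ t ∈ Set.Ioo (-1 : ℝ) 1, HasDerivAt (fun t : ℝ => ∑' n, B n * (t : ℂ) ^ n)
      (∑' n, D n * (t : ℂ) ^ n) t := fun t ht => by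
    refine (hBs.hasDerivAt (hnorm t ht)).comp_ofReal.congr_deriv ?_
    simp only [hB]
  set h : ℝ → ℂ := fun t => f t - ∑' n, B n * (t : ℂ) ^ n with hh
  have hh' : ∀ t ∈ Set.Ioo (0 : ℝ) 1, HasDerivAt h 0 t := fun t ht => by
    refine ((hf t ht).sub (hder t ⟨by linarith [ht.1], ht.2⟩)).congr_deriv ?_
    rw [(hD t ht.1 ht.2).tsum_eq, sub_self]
  have hconst : ∀ x ∈ Set.Ioo (0 : ℝ) 1, h x = h t := fun x hx =>
    IsOpen.is_const_of_deriv_eq_zero isOpen_Ioo isPreconnected_Ioo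
      (fun y hy => (hh' y hy).differentiableAt.differentiableWithinAt)
      (fun y hy => (hh' y hy).deriv) hx ⟨h0, h1⟩
  -- The derivative of `f` is controlled only on `(0, 1)`, so the constant is identified by the
  -- one-sided limit at `0`.
  have hlim : Filter.Tendsto h (nhdsWithin 0 (Set.Ioi 0)) (nhds (h 0)) :=
    (hf0.sub (hder 0 (by norm_num)).continuousAt).tendsto.mono_left nhdsWithin_le_nhds
  have hlim2 : Filter.Tendsto h (nhdsWithin 0 (Set.Ioi 0)) (nhds (h t)) := by
    refine tendsto_const_nhds.congr' ?_
    filter_upwards [Ioo_mem_nhdsGT (zero_lt_one' ℝ)] with x hx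
    exact (hconst x hx).symm
  have hh0 : h 0 = 0 := by
    simp only [hh, Complex.ofReal_zero]
    rw [tsum_eq_single 0 (fun n hn => by simp [hn])]
    simp [hB0]
  have hht : f t - ∑' n, B n * (t : ℂ) ^ n = 0 := by
    rw [← hh0]; exact tendsto_nhds_unique hlim2 hlim
  rw [sub_eq_zero.1 hht]
  exact hBs.hasSum (hnorm t ⟨by linarith, h1⟩)

/-- The coefficients of the logarithmic derivative of
`(1 + t) ^ (2 b - 1) * (1 - t) ^ (-2 b - 1 - 2 κ) * (1 + 2 t cos φ + t ^ 2) ^ κ`. -/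
noncomputable def kernelLogCoeff (b κ φ : ℝ) (n : ℕ) : ℝ :=
  2 * b * (1 + (-1) ^ n) + (1 - (-1) ^ n) + 2 * κ * (1 + (-1) ^ n * Real.cos ((n + 1) * φ))

/-- For `κ ≥ 0` every term is nonnegative. For `κ < 0` the worst cosine gives `4 (b + κ)` at even
`n` and `2 + 4κ` at odd `n`; these are the hypotheses `hbκ` and `hκ`. -/
theorem kernelLogCoeff_nonneg {b κ : ℝ} (hb : 0 < b) (hκ : -1 / 2 ≤ κ) (hbκ : 0 ≤ b + κ) (φ : ℝ)
    (n : ℕ) : 0 ≤ kernelLogCoeff b κ φ n := by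
  have h1 := Real.cos_le_one ((n + 1) * φ)
  have h2 := Real.neg_one_le_cos ((n + 1) * φ)
  rw [kernelLogCoeff]
  generalize Real.cos ((n + 1) * φ) = x at h1 h2
  rcases Nat.even_or_odd n with hn | hn
  · rw [hn.neg_one_pow]
    rcases le_total 0 κ with h | h <;> nlinarith
  · rw [hn.neg_one_pow]
    rcases le_total 0 κ with h | h <;> nlinarith

/-- The strict bound on the cosine is needed when `b + κ = 0`, which occurs for `d = 1`. -/
theorem kernelLogCoeff_zero_pos {b κ : ℝ} (hb : 0 < b) (hbκ : 0 ≤ b + κ) {φ : ℝ}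
    (hφ : Real.cos φ < 1) : 0 < kernelLogCoeff b κ φ 0 := by
  have h2 := Real.neg_one_le_cos φ
  simp only [kernelLogCoeff, pow_zero, Nat.cast_zero, zero_add, one_mul]
  rcases le_or_gt 0 κ with h | h <;> nlinarith

theorem exists_norm_kernelLogCoeff_le (b κ : ℝ) :
    ∃ K : ℕ, ∀ φ n, ‖(kernelLogCoeff b κ φ n : ℂ)‖ ≤ K := by
  obtain ⟨K, hK⟩ := exists_nat_ge (2 * |b| * 2 + 2 + 2 * |κ| * 2)
  refine ⟨K, fun φ n => le_trans ?_ hK⟩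
  rw [Complex.norm_real, Real.norm_eq_abs, kernelLogCoeff]
  have h3 : |Real.cos ((n + 1) * φ)| ≤ 1 := Real.abs_cos_le_one _
  have e : |(-1 : ℝ) ^ n| = 1 := by simp
  have h4 : |1 + (-1 : ℝ) ^ n| ≤ 2 := (abs_add_le _ _).trans (by rw [e, abs_one]; norm_num)
  have h5 : |1 - (-1 : ℝ) ^ n| ≤ 2 := (abs_sub _ _).trans (by rw [e, abs_one]; norm_num)
  have h6 : |1 + (-1 : ℝ) ^ n * Real.cos ((n + 1) * φ)| ≤ 2 :=
    (abs_add_le _ _).trans (by rw [abs_mul, e, abs_one]; linarith)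
  refine (abs_add_le _ _).trans (add_le_add ((abs_add_le _ _).trans (add_le_add ?_ h5)) ?_)
  · rw [abs_mul, abs_mul, abs_two]; gcongr
  · rw [abs_mul, abs_mul, abs_two]; gcongr

theorem one_add_two_mul_add_sq_pos {t x : ℝ} (ht : t ∈ Set.Ioo (-1 : ℝ) 1) (hx : |x| ≤ 1) :
    0 < 1 + 2 * x * t + t ^ 2 := by
  have h1 := abs_lt.2 ht
  have h2 : |x * t| ≤ |t| := by
    rw [abs_mul]; exact mul_le_of_le_one_left (abs_nonneg _) hx
  have h3 := (abs_le.1 h2).1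
  nlinarith [sq_abs t, abs_nonneg t, sq_nonneg (1 - |t|), mul_pos (sub_pos.2 h1) (sub_pos.2 h1)]

/-- The quadratic factors as `(1 + e^(iφ) t)(1 + e^(-iφ) t)`, so its logarithmic derivative is a sum
of two geometric series. -/
theorem hasSum_cos_mul_pow (φ : ℝ) {t : ℝ} (ht : t ∈ Set.Ioo (-1 : ℝ) 1) :
    HasSum (fun n : ℕ => ((2 * (-1) ^ n * Real.cos ((n + 1) * φ) : ℝ) : ℂ) * (t : ℂ) ^ n)
      (((2 * Real.cos φ + 2 * t) / (1 + 2 * Real.cos φ * t + t ^ 2) : ℝ) : ℂ) := by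
  have htn : ‖(t : ℂ)‖ < 1 := by
    rw [Complex.norm_real, Real.norm_eq_abs, abs_lt]; exact ht
  have hgeo : ∀ ψ : ℝ, HasSum (fun n : ℕ => Complex.exp (ψ * Complex.I) *
      (-(Complex.exp (ψ * Complex.I) * t)) ^ n)
      (Complex.exp (ψ * Complex.I) * (1 + Complex.exp (ψ * Complex.I) * t)⁻¹) := fun ψ => by
    have := (hasSum_geometric_of_norm_lt_one (ξ := -(Complex.exp (ψ * Complex.I) * t)) (by
      rw [norm_neg, norm_mul, Complex.norm_exp_ofReal_mul_I, one_mul]; exact htn)).mul_left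
      (Complex.exp (ψ * Complex.I))
    rwa [sub_neg_eq_add] at this
  have h := (hgeo φ).add (hgeo (-φ))
  have hpos := one_add_two_mul_add_sq_pos ht (Real.abs_cos_le_one φ)
  have hinv : Complex.exp (φ * Complex.I) * Complex.exp ((-φ : ℝ) * Complex.I) = 1 := by
    rw [← Complex.exp_add]; simp
  have hcos : 2 * (Real.cos φ : ℂ)
      = Complex.exp (φ * Complex.I) + Complex.exp ((-φ : ℝ) * Complex.I) := by
    rw [Complex.ofReal_cos, Complex.two_cos]; push_cast; ring_nf
  have hne : ∀ ψ : ℝ, 1 + Complex.exp (ψ * Complex.I) * t ≠ 0 := fun ψ =>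
    one_add_ne_zero_of_norm_lt_one (by
      rw [norm_mul, Complex.norm_exp_ofReal_mul_I, one_mul]; exact htn)
  convert! h using 1
  · ext n
    have hcosn : 2 * (Real.cos ((n + 1) * φ) : ℂ) = Complex.exp (φ * Complex.I) ^ (n + 1)
        + Complex.exp ((-φ : ℝ) * Complex.I) ^ (n + 1) := by
      rw [Complex.ofReal_cos, Complex.two_cos, ← Complex.exp_nat_mul, ← Complex.exp_nat_mul]
      push_cast; ring_nf
    rw [neg_pow (Complex.exp (φ * Complex.I) * t),
      neg_pow (Complex.exp ((-φ : ℝ) * Complex.I) * t), mul_pow, mul_pow]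
    push_cast at hcosn ⊢
    linear_combination (-1) ^ n * (t : ℂ) ^ n * hcosn
  · have hden : ((1 + 2 * Real.cos φ * t + t ^ 2 : ℝ) : ℂ) =
        (1 + Complex.exp (φ * Complex.I) * t) * (1 + Complex.exp ((-φ : ℝ) * Complex.I) * t) := by
      push_cast at hcos hinv ⊢
      linear_combination (t : ℂ) * hcos - (t : ℂ) ^ 2 * hinv
    have hn1 := hne φ
    have hn2 := hne (-φ)
    rw [Complex.ofReal_div, hden, Complex.ofReal_add, Complex.ofReal_mul, Complex.ofReal_ofNat,
      hcos]
    generalize Complex.exp (φ * Complex.I) = x at *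
    generalize Complex.exp ((-φ : ℝ) * Complex.I) = y at *
    field_simp
    push_cast
    linear_combination -2 * (t : ℂ) * hinv

theorem hasSum_kernel (b κ φ : ℝ) {t : ℝ} (ht : t ∈ Set.Ioo (-1 : ℝ) 1) :
    HasSum (fun n => ((expCoeff (kernelLogCoeff b κ φ) n : ℝ) : ℂ) * (t : ℂ) ^ n)
      (((1 + t : ℝ) : ℂ) ^ ((2 * b - 1 : ℝ) : ℂ) * ((1 - t : ℝ) : ℂ) ^ ((-2 * b - 1 - 2 * κ : ℝ) : ℂ)
        * ((1 + 2 * Real.cos φ * t + t ^ 2 : ℝ) : ℂ) ^ (κ : ℂ)) := by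
  obtain ⟨K, hK⟩ := exists_norm_kernelLogCoeff_le b κ
  have hp1 : ∀ t ∈ Set.Ioo (-1 : ℝ) 1, 0 < 1 + t := fun t ht => by linarith [ht.1]
  have hp2 : ∀ t ∈ Set.Ioo (-1 : ℝ) 1, 0 < 1 - t := fun t ht => by linarith [ht.2]
  have hp3 : ∀ t ∈ Set.Ioo (-1 : ℝ) 1, 0 < 1 + 2 * Real.cos φ * t + t ^ 2 := fun t ht =>
    one_add_two_mul_add_sq_pos ht (Real.abs_cos_le_one φ)
  simp only [ofReal_expCoeff]
  refine hasSum_expCoeff (hK φ)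
    (f := fun t => ((1 + t : ℝ) : ℂ) ^ ((2 * b - 1 : ℝ) : ℂ) *
      ((1 - t : ℝ) : ℂ) ^ ((-2 * b - 1 - 2 * κ : ℝ) : ℂ)
        * ((1 + 2 * Real.cos φ * t + t ^ 2 : ℝ) : ℂ) ^ (κ : ℂ))
    (G := fun t => ((2 * b - 1 : ℝ) : ℂ) * ((1 / (1 + t) : ℝ) : ℂ)
      + ((2 * b + 1 + 2 * κ : ℝ) : ℂ) * ((1 / (1 - t) : ℝ) : ℂ)
      + κ * (((2 * Real.cos φ + 2 * t) / (1 + 2 * Real.cos φ * t + t ^ 2) : ℝ) : ℂ))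
    (by simp)
    (fun t ht => mul_ne_zero (mul_ne_zero (ofReal_cpow_ne_zero (hp1 t ht) _)
      (ofReal_cpow_ne_zero (hp2 t ht) _)) (ofReal_cpow_ne_zero (hp3 t ht) _))
    (fun t ht => ?_) (fun t ht => ?_) ht
  · have h1 := hasSum_ofReal_geometric (t := -t) ⟨by linarith [ht.2], by linarith [ht.1]⟩
      ((2 * b - 1 : ℝ) : ℂ)
    rw [sub_neg_eq_add] at h1
    have h2 := hasSum_ofReal_geometric ht ((2 * b + 1 + 2 * κ : ℝ) : ℂ)
    have h3 := (hasSum_cos_mul_pow φ ht).mul_left (κ : ℂ)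
    refine ((h1.add h2).add h3).congr_fun fun n => ?_
    rw [kernelLogCoeff, Complex.ofReal_neg, neg_pow (t : ℂ)]
    push_cast
    ring
  · have h1 := hasDerivAt_ofReal_cpow ((hasDerivAt_id' t).const_add 1) (hp1 t ht)
      ((2 * b - 1 : ℝ) : ℂ)
    have h2 := hasDerivAt_ofReal_cpow ((hasDerivAt_id' t).const_sub 1) (hp2 t ht)
      ((-2 * b - 1 - 2 * κ : ℝ) : ℂ)
    have h3' : HasDerivAt (fun t : ℝ => 1 + 2 * Real.cos φ * t + t ^ 2)
        (2 * Real.cos φ + 2 * t) t := by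
      have := (((hasDerivAt_id' t).const_mul (2 * Real.cos φ)).const_add 1).add (hasDerivAt_pow 2 t)
      exact this.congr_deriv (by push_cast; ring)
    have h3 := hasDerivAt_ofReal_cpow h3' (hp3 t ht) (κ : ℂ)
    refine ((h1.mul h2).mul h3).congr_deriv ?_
    simp only [Pi.mul_apply]
    push_cast
    ring

theorem measurable_expCoeff_kernelLogCoeff (b κ : ℝ) (n : ℕ) :
    Measurable fun φ => expCoeff (kernelLogCoeff b κ φ) n := by
  induction n using Nat.strong_induction_on with
  | _ n ih =>
    cases n with
    | zero => simp only [expCoeff_zero]; fun_prop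
    | succ n =>
      simp only [expCoeff_succ]
      refine (Finset.measurable_fun_sum _ fun j hj => ?_).div_const _
      refine Measurable.mul ?_ (ih j (Finset.mem_range.1 hj))
      unfold kernelLogCoeff
      fun_prop

theorem betaWeight_ofReal (p q : ℝ) {s : ℝ} (hs : s ∈ Set.Ioo (0 : ℝ) 1) :
    betaWeight (p : ℂ) (q : ℂ) s = ((s ^ (p - 1) * (1 - s) ^ (q - 1) : ℝ) : ℂ) := by
  rw [betaWeight, Complex.ofReal_mul, Complex.ofReal_cpow hs.1.le,
    Complex.ofReal_cpow (sub_pos.2 hs.2).le]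
  push_cast
  rfl

/-- The mean of a bounded positive function against a real Beta weight is positive. -/
theorem exists_pos_integral_betaWeight {p q : ℝ} (hp : 0 < p) (hq : 0 < q) {k : ℝ → ℝ}
    (hk : Measurable k) {M : ℝ} (hM : ∀ s ∈ Set.Ioo (0 : ℝ) 1, ‖(k s : ℂ)‖ ≤ M)
    (hpos : ∀ s ∈ Set.Ioo (0 : ℝ) 1, 0 < k s) :
    ∃ x : ℝ, 0 < x ∧ ∫ s in Set.Ioo (0 : ℝ) 1, betaWeight p q s * (k s : ℂ) = x := by
  have hw := integrableOn_betaWeight (p := p) (q := q) (by simpa) (by simpa)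
  have hint : IntegrableOn (fun s => betaWeight p q s * (k s : ℂ)) (Set.Ioo 0 1) :=
    hw.mul_bdd (Complex.measurable_ofReal.comp hk).aestronglyMeasurable (by
      filter_upwards [ae_restrict_mem measurableSet_Ioo] with s hs using hM s hs)
  set f : ℝ → ℝ := fun s => s ^ (p - 1) * (1 - s) ^ (q - 1) * k s with hf
  have hfe : Set.EqOn (fun s => betaWeight p q s * (k s : ℂ)) (fun s => ((f s : ℝ) : ℂ))
      (Set.Ioo 0 1) := fun s hs => by
    simp only [hf, betaWeight_ofReal p q hs]; push_cast; rfl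
  have hfi : IntegrableOn f (Set.Ioo 0 1) := by
    exact (hint.congr_fun hfe measurableSet_Ioo).re
  refine ⟨∫ s in Set.Ioo (0 : ℝ) 1, f s, ?_, ?_⟩
  · rw [← integral_Ioc_eq_integral_Ioo, ← intervalIntegral.integral_of_le zero_le_one]
    refine intervalIntegral.intervalIntegral_pos_of_pos_on
      ((intervalIntegrable_iff_integrableOn_Ioo_of_le zero_le_one).2 hfi) (fun s hs => ?_) one_pos
    have h1 : 0 < 1 - s := sub_pos.2 hs.2
    have h2 := hpos s hs
    have h3 : 0 < s := hs.1
    simp only [hf]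
    positivity
  · rw [setIntegral_congr_fun measurableSet_Ioo hfe]
    exact integral_ofReal

/-- The radial derivative of the Gauss series as an integral of kernels whose radial expansions
have positive coefficients. -/
theorem regularizedGauss_succ_koebe_eq_integral {b κ : ℝ} (hb : 0 < b) (hκ : -1 < κ)
    {ρ : ℝ} (h0 : 0 < ρ) (h1 : ρ < 1) :
    Complex.Gamma (b + 1 : ℝ) * Complex.Gamma (κ + 1 : ℝ) *
      (((1 - ρ) / (1 + ρ) ^ 3 : ℝ) * Complex.regularizedGaussHGFun (b + 2 * κ + 2 : ℝ) (b + 1 : ℝ)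
        (b + κ + 2 : ℝ) ((4 * ρ / (1 + ρ) ^ 2 : ℝ) : ℂ))
      = ∫ s in Set.Ioo (0 : ℝ) 1, betaWeight (b + 1 : ℝ) (κ + 1 : ℝ) s *
          (((1 + ρ : ℝ) : ℂ) ^ ((2 * b - 1 : ℝ) : ℂ) *
            ((1 - ρ : ℝ) : ℂ) ^ ((-2 * b - 1 - 2 * κ : ℝ) : ℂ)
            * ((1 + 2 * Real.cos (Real.arccos (2 * s - 1)) * ρ + ρ ^ 2 : ℝ) : ℂ) ^ (κ : ℂ)) := by
  have hρ1 : 0 < 1 - ρ := sub_pos.2 h1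
  have hρ2 : 0 < 1 + ρ := by linarith
  have hz1 : 1 - 4 * ρ / (1 + ρ) ^ 2 = ((1 - ρ) / (1 + ρ)) ^ 2 := by field_simp; ring
  have hcb : ((b + κ + 2 : ℝ) : ℂ) - ((b + 1 : ℝ) : ℂ) = ((κ + 1 : ℝ) : ℂ) := by push_cast; ring
  have hE := euler_integral (a := ((b + 2 * κ + 2 : ℝ) : ℂ)) (b := ((b + 1 : ℝ) : ℂ))
    (c := ((b + κ + 2 : ℝ) : ℂ))
    (by rw [Complex.ofReal_re]; linarith) (by rw [hcb, Complex.ofReal_re]; linarith)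
    (koebe_mem_Ioo h0 h1)
  rw [hcb] at hE
  -- This `l` is `B⁻¹`: the factor with exponent `-(b + 2κ + 2)` becomes `1`, leaving a single
  -- quadratic in `ρ` to the power `κ`.
  have hsc := integral_betaWeight_scaling (A := 1) (B := ((1 - ρ) / (1 + ρ)) ^ 2)
    (l := ((1 + ρ) / (1 - ρ)) ^ 2) one_pos (by positivity) (by positivity)
    (p := ((b + 1 : ℝ) : ℂ)) (q := ((κ + 1 : ℝ) : ℂ))
    (α := -(κ : ℂ)) (β := ((b + 2 * κ + 2 : ℝ) : ℂ)) (by push_cast; ring)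
  have hB : ∀ s : ℝ, 1 - s + ((1 - ρ) / (1 + ρ)) ^ 2 * s = 1 - 4 * ρ / (1 + ρ) ^ 2 * s := by
    intro s; rw [← hz1]; ring
  have hB2 : ((1 + ρ) / (1 - ρ)) ^ 2 * ((1 - ρ) / (1 + ρ)) ^ 2 = 1 := by field_simp
  simp only [one_mul, sub_add_cancel, Complex.ofReal_one, Complex.one_cpow, hB, hB2, mul_one,
    neg_neg] at hsc
  rw [mul_left_comm, hE, hsc, ← integral_const_mul, ← integral_const_mul]
  refine setIntegral_congr_fun measurableSet_Ioo fun s hs => ?_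
  have hcos : Real.cos (Real.arccos (2 * s - 1)) = 2 * s - 1 :=
    Real.cos_arccos (by linarith [hs.1]) (by linarith [hs.2])
  have hpos : 0 < 1 + 2 * (2 * s - 1) * ρ + ρ ^ 2 :=
    one_add_two_mul_add_sq_pos ⟨by linarith, h1⟩ (by
      rw [abs_le]; constructor <;> linarith [hs.1, hs.2])
  have hd : 1 - s + ((1 + ρ) / (1 - ρ)) ^ 2 * s
      = (1 + 2 * (2 * s - 1) * ρ + ρ ^ 2) / (1 - ρ) ^ 2 := by
    field_simp; ring
  have hpre : (((1 - ρ) / (1 + ρ) ^ 3 : ℝ) : ℂ)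
      = Complex.exp ((Real.log (1 - ρ) : ℝ) - 3 * (Real.log (1 + ρ) : ℝ)) := by
    rw [← Complex.cpow_one (((1 - ρ) / (1 + ρ) ^ 3 : ℝ) : ℂ), ofReal_cpow_eq_exp (by positivity),
      Real.log_div hρ1.ne' (by positivity), Real.log_pow]
    push_cast
    ring_nf
  simp only [hd, hcos]
  rw [hpre, ofReal_cpow_eq_exp (by positivity), ofReal_cpow_eq_exp (by positivity),
    ofReal_cpow_eq_exp hρ1, ofReal_cpow_eq_exp hρ2, ofReal_cpow_eq_exp hpos,
    Real.log_pow, Real.log_div hpos.ne' (by positivity), Real.log_div hρ2.ne' hρ1.ne',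
    Real.log_pow, mul_left_comm, mul_left_comm _ (betaWeight _ _ _),
    mul_left_comm _ (betaWeight _ _ _)]
  simp only [← Complex.exp_add]
  congr 2
  push_cast
  ring

/-- Positivity of the radial coefficients for real parameters. -/
theorem exists_pos_radial_of_real {b κ : ℝ} (hb : 0 < b) (hκ : -1 / 2 ≤ κ) (hbκ : 0 ≤ b + κ) :
    ∃ B : ℕ → ℝ, (∀ n, 0 < B n) ∧ ∀ ρ : ℝ, 0 < ρ → ρ < 1 →
      HasSum (fun n => (B n : ℂ) * (ρ : ℂ) ^ n)
        (Complex.regularizedGaussHGFun (b + 2 * κ + 1 : ℝ) (b : ℝ) (b + κ + 1 : ℝ)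
          ((4 * ρ / (1 + ρ) ^ 2 : ℝ) : ℂ)) := by
  obtain ⟨K, hK⟩ := exists_norm_kernelLogCoeff_le b κ
  have hmeas : ∀ n, Measurable fun s : ℝ =>
      expCoeff (kernelLogCoeff b κ (Real.arccos (2 * s - 1))) n := fun n =>
    (measurable_expCoeff_kernelLogCoeff b κ n).comp
      (Real.measurable_arccos.comp (by fun_prop))
  have hbound : ∀ n, ∀ s : ℝ,
      ‖((expCoeff (kernelLogCoeff b κ (Real.arccos (2 * s - 1))) n : ℝ) : ℂ)‖
        ≤ ((n + K).choose K : ℝ) := fun n s => by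
    rw [ofReal_expCoeff]; exact norm_expCoeff_le (hK _) n
  have hmean : ∀ n, ∃ x : ℝ, 0 < x ∧ ∫ s in Set.Ioo (0 : ℝ) 1,
      betaWeight (b + 1 : ℝ) (κ + 1 : ℝ) s *
        ((expCoeff (kernelLogCoeff b κ (Real.arccos (2 * s - 1))) n : ℝ) : ℂ) = x := fun n =>
    exists_pos_integral_betaWeight (by linarith) (by linarith) (hmeas n)
      (fun s _ => hbound n s) fun s hs =>
        expCoeff_pos (kernelLogCoeff_nonneg hb hκ hbκ _)
          (kernelLogCoeff_zero_pos hb hbκ (by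
            rw [Real.cos_arccos (by linarith [hs.1]) (by linarith [hs.2])]
            linarith [hs.2])) n
  choose m hm0 hm using hmean
  have hsum : ∀ ρ : ℝ, 0 < ρ → ρ < 1 → HasSum (fun n => (m n : ℂ) * (ρ : ℂ) ^ n) _ :=
    fun ρ h0 h1 => by
    have hρn : ‖(ρ : ℂ)‖ < 1 := by
      rw [Complex.norm_real, Real.norm_of_nonneg h0.le]; exact h1
    have h := hasSum_integral_betaWeight_mul (p := (b + 1 : ℝ)) (q := (κ + 1 : ℝ))
      (by rw [Complex.ofReal_re]; linarith) (by rw [Complex.ofReal_re]; linarith)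
      (k := fun n s => ((expCoeff (kernelLogCoeff b κ (Real.arccos (2 * s - 1))) n : ℝ) : ℂ)
        * (ρ : ℂ) ^ n)
      (fun n => (Complex.measurable_ofReal.comp (hmeas n)).mul_const _)
      (M := fun n => ((n + K).choose K : ℝ) * ρ ^ n)
      (fun n s _ => by
        rw [norm_mul, norm_pow, Complex.norm_real ρ, Real.norm_of_nonneg h0.le]
        gcongr
        exact hbound n s)
      (by simpa using discSummable_choose K ρ h0.le h1)
      (fun s _ => hasSum_kernel b κ _ ⟨by linarith, h1⟩)
    rw [← regularizedGauss_succ_koebe_eq_integral hb (by linarith) h0 h1] at h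
    refine h.congr_fun fun n => ?_
    rw [← hm n, ← integral_mul_const]
    exact integral_congr_ae (Filter.Eventually.of_forall fun s => by ring)
  set a : ℝ := b + 2 * κ + 1 with ha
  -- The `4` comes from differentiating `4ρ/(1+ρ)²`, `a * b` from differentiating the Gauss series,
  -- and the Gamma factors from Euler's integral.
  set C : ℝ := 4 * a * b / (Real.Gamma (b + 1) * Real.Gamma (κ + 1)) with hC
  have hΓ1 := Real.Gamma_pos_of_pos (show 0 < b + 1 by linarith)
  have hΓ2 := Real.Gamma_pos_of_pos (show 0 < κ + 1 by linarith)
  have hΓ3 := Real.Gamma_pos_of_pos (show 0 < b + κ + 1 by linarith)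
  have hCpos : 0 < C := by
    have : 0 < a := by rw [ha]; linarith
    positivity
  set B : ℕ → ℝ := fun n => Nat.casesOn n (Real.Gamma (b + κ + 1))⁻¹ fun n => C * m n / (n + 1)
    with hB
  refine ⟨B, fun n => ?_, fun ρ h0 h1 => ?_⟩
  · cases n with
    | zero => exact inv_pos.2 hΓ3
    | succ n => exact div_pos (mul_pos hCpos (hm0 n)) (by positivity)
  -- The endpoint `0` is included because continuity there fixes the constant of integration.
  have hn0 : ∀ t ∈ Set.Ico (0 : ℝ) 1, ‖((4 * t / (1 + t) ^ 2 : ℝ) : ℂ)‖ < 1 := fun t ht => by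
    have h0 := ht.1
    rw [Complex.norm_real, Real.norm_of_nonneg (by positivity), div_lt_one (by positivity)]
    nlinarith [ht.2]
  have hz : ∀ t ∈ Set.Ico (0 : ℝ) 1, HasDerivAt (fun t : ℝ => 4 * t / (1 + t) ^ 2)
      (4 * ((1 - t) / (1 + t) ^ 3)) t := fun t ht => by
    have hpos : 0 < 1 + t := by linarith [ht.1]
    have h1 := ((hasDerivAt_id' t).const_mul 4).div (((hasDerivAt_id' t).const_add 1).pow 2)
      (pow_ne_zero 2 hpos.ne')
    refine h1.congr_deriv ?_
    simp only [Pi.pow_apply]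
    field_simp
    ring
  have hder : ∀ t ∈ Set.Ico (0 : ℝ) 1, HasDerivAt (fun t : ℝ =>
      Complex.regularizedGaussHGFun a b (b + κ + 1 : ℝ) ((4 * t / (1 + t) ^ 2 : ℝ) : ℂ))
      (a * b * Complex.regularizedGaussHGFun (a + 1) (b + 1) ((b + κ + 1 : ℝ) + 1)
        ((4 * t / (1 + t) ^ 2 : ℝ) : ℂ) * ((4 * ((1 - t) / (1 + t) ^ 3) : ℝ) : ℂ)) t :=
    fun t ht => (hasDerivAt_regularizedGauss _ _ _ (hn0 t ht)).comp t (hz t ht).ofReal_comp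
  refine hasSum_of_hasDerivAt (hder 0 (by simp)).continuousAt
    (fun t ht => hder t ⟨ht.1.le, ht.2⟩) (D := fun n => ((C * m n : ℝ) : ℂ))
    (B := fun n => (B n : ℂ)) (fun t ht0 ht1 => ?_) ?_ (fun n => ?_) h0 h1
  · have h := (hsum t ht0 ht1).mul_left (C : ℂ)
    convert! h using 1
    · ext n; push_cast; ring
    · rw [Complex.Gamma_ofReal, Complex.Gamma_ofReal, hC,
        show (b + 2 * κ + 2 : ℝ) = a + 1 by rw [ha]; ring,
        show (b + κ + 2 : ℝ) = b + κ + 1 + 1 by ring]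
      have e1 : (Real.Gamma (b + 1) : ℂ) ≠ 0 := by exact_mod_cast hΓ1.ne'
      have e2 : (Real.Gamma (κ + 1) : ℂ) ≠ 0 := by exact_mod_cast hΓ2.ne'
      simp only [Complex.ofReal_add, Complex.ofReal_one]
      generalize Complex.regularizedGaussHGFun _ _ _ _ = F
      generalize (1 - t) / (1 + t) ^ 3 = x
      push_cast
      field_simp
  · have h := hasSum_regularizedGauss a b (b + κ + 1 : ℝ) (z := 0) (by simp)
    have h2 := h.unique (hasSum_single 0 fun n hn => by simp [hn])
    simp only [mul_zero, zero_div, Complex.ofReal_zero]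
    rw [h2, hB]
    simp [-Complex.ofReal_add, Complex.Gamma_ofReal]
  · have hn : ((n : ℂ) + 1) ≠ 0 := by exact_mod_cast n.succ_ne_zero
    simp only [hB]
    push_cast
    field_simp

/-! ### The propagator in the principal and complementary series. -/

/-- The propagator in the radial variable, given the radial expansion of the Gauss series. -/
theorem freePropagator_of_radial {d : ℕ} {lam : ℂ} {B : ℕ → ℝ} {C : ℝ}
    (hC : Complex.Gamma (d / 2 + Complex.I * lam) * Complex.Gamma (d / 2 - Complex.I * lam) = C)
    (hB : ∀ ρ : ℝ, 0 < ρ → ρ < 1 → HasSum (fun n => (B n : ℂ) * (ρ : ℂ) ^ n)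
      (Complex.regularizedGaussHGFun (d / 2 + Complex.I * lam) (d / 2 - Complex.I * lam)
        ((d + 1) / 2) ((4 * ρ / (1 + ρ) ^ 2 : ℝ) : ℂ))) :
    DifferentiableOn ℂ (freePropagator d lam) {σ : ℂ | (1 + σ) / 2 ∈ cutPlane} ∧
      ∀ σ ρ : ℂ, ‖ρ‖ < 1 → (1 + σ) / 2 = 4 * ρ / (1 + ρ) ^ 2 →
        HasSum (fun n : ℕ => ((C / (4 * Real.pi) ^ (((d : ℝ) + 1) / 2) * B n : ℝ) : ℂ) * ρ ^ n)
          (freePropagator d lam σ) := by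
  obtain ⟨hd, hs⟩ := regularizedF_of_hasSum (B := fun n => (B n : ℂ)) hB
  constructor
  · have h : DifferentiableOn ℂ (fun σ : ℂ => (1 + σ) / 2) {σ : ℂ | (1 + σ) / 2 ∈ cutPlane} := by
      fun_prop
    exact (hd.comp h fun σ hσ => hσ).const_mul _
  · intro σ ρ hρ hσ
    rw [freePropagator, hC, hσ]
    refine ((hs ρ hρ).mul_left _).congr_fun fun n => ?_
    push_cast
    ring

theorem exists_radial_of_principal {d : ℕ} (hd : 1 ≤ d) {lam : ℂ} (h : IsPrincipal lam) :
    (∃ B : ℕ → ℝ, (∀ n, 0 ≤ B n) ∧ ∀ ρ : ℝ, 0 < ρ → ρ < 1 →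
      HasSum (fun n => (B n : ℂ) * (ρ : ℂ) ^ n)
      (Complex.regularizedGaussHGFun (d / 2 + Complex.I * lam) (d / 2 - Complex.I * lam)
        ((d + 1) / 2) ((4 * ρ / (1 + ρ) ^ 2 : ℝ) : ℂ))) ∧
    ∃ C : ℝ, 0 < C ∧
      Complex.Gamma (d / 2 + Complex.I * lam) * Complex.Gamma (d / 2 - Complex.I * lam) = C := by
  obtain ⟨x, rfl⟩ := h
  have hconj : (d / 2 - Complex.I * x : ℂ) = (starRingEnd ℂ) (d / 2 + Complex.I * x) := by
    simp [sub_eq_add_neg, map_ofNat]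
  refine ⟨exists_nonneg_radial_of_conj hd (by ring) hconj,
    Complex.normSq (Complex.Gamma (d / 2 + Complex.I * x)), ?_, ?_⟩
  · refine Complex.normSq_pos.2 (Complex.Gamma_ne_zero_of_re_pos ?_)
    have : (d / 2 + Complex.I * x : ℂ).re = d / 2 := by simp
    rw [this]
    positivity
  · rw [hconj, Complex.Gamma_conj, Complex.mul_conj]

theorem exists_radial_of_complementary {d : ℕ} (hd : 1 ≤ d) {lam : ℂ}
    (h : IsComplementary d lam) :
    (∃ B : ℕ → ℝ, (∀ n, 0 < B n) ∧ ∀ ρ : ℝ, 0 < ρ → ρ < 1 →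
      HasSum (fun n => (B n : ℂ) * (ρ : ℂ) ^ n)
      (Complex.regularizedGaussHGFun (d / 2 + Complex.I * lam) (d / 2 - Complex.I * lam)
        ((d + 1) / 2) ((4 * ρ / (1 + ρ) ^ 2 : ℝ) : ℂ))) ∧
    ∃ C : ℝ, 0 < C ∧
      Complex.Gamma (d / 2 + Complex.I * lam) * Complex.Gamma (d / 2 - Complex.I * lam) = C := by
  obtain ⟨x, hx, hIx⟩ := h
  have hd' : (1 : ℝ) ≤ d := by exact_mod_cast hd
  rw [hIx]
  constructor
  · have habs : |x| < d / 2 := abs_lt.2 ⟨by linarith [hx.1], hx.2⟩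
    -- Taking `b` as the smaller parameter ensures `κ ≥ -1/2`; moreover `b + κ = (d - 1)/2 ≥ 0`.
    -- When `x < 0` the two parameters are swapped by symmetry.
    obtain ⟨B, hB0, hB⟩ := exists_pos_radial_of_real (b := d / 2 - |x|) (κ := |x| - 1 / 2)
      (by linarith) (by linarith [abs_nonneg x]) (by linarith)
    refine ⟨B, hB0, fun ρ h0 h1 => ?_⟩
    have h := hB ρ h0 h1
    rw [show ((d / 2 - |x| + (|x| - 1 / 2) + 1 : ℝ) : ℂ) = (d + 1) / 2 by push_cast; ring] at h
    rcases abs_choice x with hax | hax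
    · rw [hax] at h
      convert! h using 2 <;> push_cast <;> ring
    · rw [hax] at h
      rw [Complex.regularizedGaussHGFun_symm]
      convert! h using 2 <;> push_cast <;> ring
  · refine ⟨Real.Gamma (d / 2 + x) * Real.Gamma (d / 2 - x), mul_pos
      (Real.Gamma_pos_of_pos (by linarith [hx.1])) (Real.Gamma_pos_of_pos (by linarith [hx.2])), ?_⟩
    rw [Complex.ofReal_mul, ← Complex.Gamma_ofReal, ← Complex.Gamma_ofReal]
    push_cast
    rfl

end DeSitter

theorem proposition1 (d : ℕ) (hd : 1 ≤ d) (lam : ℂ)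
    (hlam : DeSitter.IsPrincipal lam ∨ DeSitter.IsComplementary d lam) :
    DifferentiableOn ℂ (DeSitter.freePropagator d lam)
      {σ : ℂ | (1 + σ) / 2 ∈ DeSitter.cutPlane} ∧
    ∃ B : ℕ → ℝ,
      (∀ n, 0 ≤ B n) ∧
      (DeSitter.IsComplementary d lam → ∀ n, 0 < B n) ∧
      ∀ σ ρ : ℂ, ‖ρ‖ < 1 → (1 + σ) / 2 = 4 * ρ / (1 + ρ) ^ 2 →
        HasSum (fun n : ℕ => (B n : ℂ) * ρ ^ n) (DeSitter.freePropagator d lam σ) := by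
  have hpi : (0 : ℝ) < (4 * Real.pi) ^ (((d : ℝ) + 1) / 2) :=
    Real.rpow_pos_of_pos (by positivity) _
  -- The complementary case is split off first because `λ = 0` belongs to both series and requires
  -- strict positivity.
  by_cases hc : DeSitter.IsComplementary d lam
  · obtain ⟨⟨B, hB0, hB⟩, C, hC0, hC⟩ := DeSitter.exists_radial_of_complementary hd hc
    obtain ⟨h1, h2⟩ := DeSitter.freePropagator_of_radial hC hB
    have hpos := fun n => mul_pos (div_pos hC0 hpi) (hB0 n)
    exact ⟨h1, _, fun n => (hpos n).le, fun _ => hpos, h2⟩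
  · obtain ⟨⟨B, hB0, hB⟩, C, hC0, hC⟩ :=
      DeSitter.exists_radial_of_principal hd (hlam.resolve_right hc)
    obtain ⟨h1, h2⟩ := DeSitter.freePropagator_of_radial hC hB
    exact ⟨h1, _, fun n => mul_nonneg (div_pos hC0 hpi).le (hB0 n), fun h => absurd h hc, h2⟩
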